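/- Let $F$ be a field. A \emph{reduced skew set} of degree $n\ge 1$ is a family of scalars $c_{ijk}\in F$ ($1\le i,j,k\le n$) with $c_{iij}=c_{ijj}=1$ for all $i,j$; the associated \emph{skew matrix algebra} $M_n(F;c)$ is the unital, not necessarily associative $F$-algebra with basis $\{e_{ij}\}_{1\le i,j\le n}$ and multiplication $e_{ij}e_{k\ell}=\delta_{jk}c_{ij\ell}e_{i\ell}$. A finite-dimensional unital, not necessarily associative $F$-algebra $A\neq 0$ with center $F$ is \emph{semiassociative} if there is an étale $F$-subalgebra $K$ (with the same unit) of its nucleus such that $A$, as a $K\otimes_F K$-module via $(k\otimes k')a=kak'$, is minimally faithful, i.e. faithful and without faithful proper sections (quotients of submodules). Call algebras $A,B$ \emph{skew equivalent} if $A\otimes_F M_n(F;c)\cong B\otimes_F M_{n'}(F;c')$ for some skew matrix algebras of degrees $n,n'\ge 1$. The semiassociative Brauer monoid $\mathrm{Br}_{sa}(F)$ is the set of skew equivalence classes $[A]^{sa}$ of semiassociative $F$-algebras, with product $[A]^{sa}[B]^{sa}=[A\otimes_F B]^{sa}$ and identity $[F]^{sa}$. Let $\mathrm{Br}(F)$ be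 the classical Brauer group of $F$. Then: 1. If two finite-dimensional associative central simple $F$-algebras $A,B$ are skew equivalent, then they are Brauer equivalent in the classical sense, i.e. $M_n(A)\cong M_m(B)$ as $F$-algebras for some $n,m\ge 1$. 2. Every finite-dimensional associative central simple $F$-algebra is semiassociative, and $[A]\mapsto[A]^{sa}$ is a well-defined injective homomorphism of monoids $\mathrm{Br}(F)\hookrightarrow\mathrm{Br}_{sa}(F)$. -/

import Mathlib

open scoped TensorProduct

universe u v w

/-! ## Skew matrix algebras -/

/-- A reduced skew set over `F` with indices in `ι`: scalars `c i j k` with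
`c i i j = c i j j = 1`. -/
structure SkewSet (F : Type u) (ι : Type v) [Field F] where
  coeff : ι → ι → ι → F
  left_one : ∀ i j, coeff i i j = 1
  right_one : ∀ i j, coeff i j j = 1

/-- The skew matrix algebra of a reduced skew set `c`: as a vector space these are the square
matrices, and the matrix units multiply by `e i j * e j l = c i j l • e i l`. -/
def SkewMatrix {F : Type u} {ι : Type v} [Field F] (_c : SkewSet F ι) : Type (max u v) :=
  Matrix ι ι F

namespace SkewMatrix

variable {F : Type u} {ι : Type v} [Field F] (c : SkewSet F ι)

instance : AddCommGroup (SkewMatrix c) := inferInstanceAs (AddCommGroup (Matrix ι ι F))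

instance : Module F (SkewMatrix c) := inferInstanceAs (Module F (Matrix ι ι F))

variable {c}

@[ext] theorem ext {x y : SkewMatrix c} (h : ∀ i j, x i j = y i j) : x = y :=
  funext fun i => funext fun j => h i j

@[simp] theorem add_apply (x y : SkewMatrix c) (i j : ι) : (x + y) i j = x i j + y i j := rfl

@[simp] theorem zero_apply (i j : ι) : (0 : SkewMatrix c) i j = 0 := rfl

@[simp] theorem smul_apply (r : F) (x : SkewMatrix c) (i j : ι) : (r • x) i j = r * x i j := rfl

section

variable [DecidableEq ι]

instance : One (SkewMatrix c) where
  one := fun i j => if i = j then 1 else 0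

theorem one_apply (i j : ι) : (1 : SkewMatrix c) i j = if i = j then 1 else 0 := rfl

end

variable [Fintype ι]

instance : Mul (SkewMatrix c) where
  mul x y := fun i l => ∑ j, c.coeff i j l * (x i j * y j l)

theorem mul_apply (x y : SkewMatrix c) (i l : ι) :
    (x * y) i l = ∑ j, c.coeff i j l * (x i j * y j l) := rfl

variable [DecidableEq ι]

instance : NonAssocRing (SkewMatrix c) where
  left_distrib x y z := by
    ext i l; simp [mul_apply, mul_add, Finset.sum_add_distrib]
  right_distrib x y z := by
    ext i l; simp [mul_apply, mul_add, add_mul, Finset.sum_add_distrib]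
  zero_mul x := by ext i l; simp [mul_apply]
  mul_zero x := by ext i l; simp [mul_apply]
  one_mul x := by ext i l; simp [mul_apply, one_apply, c.left_one]
  mul_one x := by ext i l; simp [mul_apply, one_apply, c.right_one]

instance : IsScalarTower F (SkewMatrix c) (SkewMatrix c) where
  smul_assoc r x y := by
    ext i l
    simp only [smul_eq_mul, mul_apply, smul_apply, Finset.mul_sum]
    exact Finset.sum_congr rfl fun j _ => by ring

instance : SMulCommClass F (SkewMatrix c) (SkewMatrix c) where
  smul_comm r x y := by
    ext i l
    simp only [smul_eq_mul, mul_apply, smul_apply, Finset.mul_sum]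
    exact Finset.sum_congr rfl fun j _ => by ring

end SkewMatrix

/-! ## Isomorphisms of nonassociative algebras -/

section Iso

variable (F : Type u) [Field F]

/-- Two (unital, not necessarily associative) `F`-algebras are isomorphic. A multiplicative
linear bijection automatically respects the unit. -/
def IsAlgIso (A : Type*) (B : Type*) [NonAssocRing A] [Module F A]
    [NonAssocRing B] [Module F B] : Prop :=
  ∃ e : A ≃ₗ[F] B, ∀ x y : A, e (x * y) = e x * e y

/-- `A ⊗ M ≅ B ⊗ M'` for skew matrix algebras `M`, `M'` of positive degree. -/
def IsSkewEquivalent (A : Type*) (B : Type*)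
    [NonAssocRing A] [Module F A] [SMulCommClass F A A] [IsScalarTower F A A]
    [NonAssocRing B] [Module F B] [SMulCommClass F B B] [IsScalarTower F B B] : Prop :=
  ∃ (n n' : ℕ) (c : SkewSet F (Fin n)) (c' : SkewSet F (Fin n')), 0 < n ∧ 0 < n' ∧
    IsAlgIso F (A ⊗[F] SkewMatrix c) (B ⊗[F] SkewMatrix c')

namespace IsAlgIso

variable {F}
variable {A A' B B' C D : Type*}
  [NonAssocRing A] [Module F A] [NonAssocRing A'] [Module F A']
  [NonAssocRing B] [Module F B] [NonAssocRing B'] [Module F B']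
  [NonAssocRing C] [Module F C] [NonAssocRing D] [Module F D]

theorem refl : IsAlgIso F A A := ⟨LinearEquiv.refl F A, fun _ _ => rfl⟩

theorem symm (h : IsAlgIso F A B) : IsAlgIso F B A := by
  obtain ⟨e, he⟩ := h
  exact ⟨e.symm, fun x y => e.injective (by simp [he])⟩

theorem trans (h : IsAlgIso F A B) (h' : IsAlgIso F B C) : IsAlgIso F A C := by
  obtain ⟨e, he⟩ := h
  obtain ⟨f, hf⟩ := h'
  exact ⟨e.trans f, fun x y => by simp [he, hf]⟩

variable [SMulCommClass F A A] [IsScalarTower F A A] [SMulCommClass F A' A'] [IsScalarTower F A' A']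
  [SMulCommClass F B B] [IsScalarTower F B B] [SMulCommClass F B' B'] [IsScalarTower F B' B']
  [SMulCommClass F C C] [IsScalarTower F C C] [SMulCommClass F D D] [IsScalarTower F D D]


theorem map_mul_of_tmul {R : Type*} [NonAssocRing R] [Module F R] (e : A ⊗[F] B ≃ₗ[F] R)
    (h : ∀ a b a' b', e ((a * a') ⊗ₜ (b * b')) = e (a ⊗ₜ b) * e (a' ⊗ₜ b')) (x y : A ⊗[F] B) :
    e (x * y) = e x * e y := by
  induction x with
  | zero => simp
  | add x x' hx hx' => simp [add_mul, hx, hx']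
  | tmul a b =>
    induction y with
    | zero => simp
    | add y y' hy hy' => simp [mul_add, hy, hy']
    | tmul a' b' => simp [h]

theorem tensor (h : IsAlgIso F A A') (h' : IsAlgIso F B B') :
    IsAlgIso F (A ⊗[F] B) (A' ⊗[F] B') := by
  obtain ⟨e, he⟩ := h
  obtain ⟨f, hf⟩ := h'
  exact ⟨TensorProduct.congr e f,
    map_mul_of_tmul (TensorProduct.congr e f) fun a b a' b' => by simp [he, hf]⟩

theorem comm : IsAlgIso F (A ⊗[F] B) (B ⊗[F] A) :=
  ⟨TensorProduct.comm F A B,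
    map_mul_of_tmul (TensorProduct.comm F A B) fun a b a' b' => by simp⟩

theorem lid : IsAlgIso F (F ⊗[F] A) A :=
  ⟨TensorProduct.lid F A,
    map_mul_of_tmul (TensorProduct.lid F A) fun a b a' b' => by
      simp [mul_smul, smul_mul_assoc, mul_smul_comm, smul_comm a a']⟩

theorem assoc : IsAlgIso F ((A ⊗[F] B) ⊗[F] C) (A ⊗[F] (B ⊗[F] C)) := by
  refine ⟨TensorProduct.assoc F A B C, fun x y => ?_⟩
  refine map_mul_of_tmul (A := A ⊗[F] B) (B := C) (R := A ⊗[F] (B ⊗[F] C)) (TensorProduct.assoc F A B C)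
    (fun x c x' c' => ?_) x y
  induction x with
  | zero => simp
  | add x y hx hy => simp only [add_mul, TensorProduct.add_tmul, map_add, hx, hy]
  | tmul a b =>
    induction x' with
    | zero => simp
    | add x y hx hy => simp only [mul_add, TensorProduct.add_tmul, map_add, hx, hy]
    | tmul a' b' => simp

theorem tensorComm : IsAlgIso F ((A ⊗[F] B) ⊗[F] (C ⊗[F] D)) ((A ⊗[F] C) ⊗[F] (B ⊗[F] D)) := by
  refine ⟨TensorProduct.tensorTensorTensorComm F A B C D, fun x y => ?_⟩
  refine map_mul_of_tmul (A := A ⊗[F] B) (B := C ⊗[F] D)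
    (R := (A ⊗[F] C) ⊗[F] (B ⊗[F] D))
    (TensorProduct.tensorTensorTensorComm F A B C D) (fun x z x' z' => ?_) x y
  induction x with
  | zero => simp
  | add x y hx hy => simp only [add_mul, TensorProduct.add_tmul, map_add, hx, hy]
  | tmul a b =>
    induction x' with
    | zero => simp
    | add x y hx hy => simp only [mul_add, TensorProduct.add_tmul, map_add, hx, hy]
    | tmul a' b' =>
      induction z with
      | zero => simp
      | add x y hx hy => simp only [add_mul, TensorProduct.tmul_add, map_add, hx, hy]
      | tmul c d =>
        induction z' with
        | zero => simp
        | add x y hx hy => simp only [mul_add, TensorProduct.tmul_add, map_add, hx, hy]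
        | tmul c' d' => simp

end IsAlgIso

/-! ## Tensor products of skew matrix algebras -/

namespace SkewSet

variable {F} {ι κ : Type*}

/-- The tensor product of two skew sets. -/
def tensor (c : SkewSet F ι) (d : SkewSet F κ) : SkewSet F (ι × κ) where
  coeff i j k := c.coeff i.1 j.1 k.1 * d.coeff i.2 j.2 k.2
  left_one i j := by simp [c.left_one, d.left_one]
  right_one i j := by simp [c.right_one, d.right_one]

/-- Renaming of the indices of a skew set. -/
def reindex (e : κ ≃ ι) (c : SkewSet F ι) : SkewSet F κ where
  coeff i j k := c.coeff (e i) (e j) (e k)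
  left_one _ _ := c.left_one _ _
  right_one _ _ := c.right_one _ _

variable [Fintype ι] [DecidableEq ι] [Fintype κ] [DecidableEq κ]

theorem reindex_iso (e : κ ≃ ι) (c : SkewSet F ι) :
    IsAlgIso F (SkewMatrix c) (SkewMatrix (c.reindex e)) := by
  refine ⟨{ toFun := fun x i j => x (e i) (e j), invFun := fun x i j => x (e.symm i) (e.symm j),
            map_add' := fun _ _ => rfl, map_smul' := fun _ _ => rfl,
            left_inv := fun x => ?_, right_inv := fun x => ?_ }, fun x y => ?_⟩
  · ext i j; simp
  · ext i j; simp
  · ext i l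
    change (x * y) (e i) (e l) = _
    rw [SkewMatrix.mul_apply, SkewMatrix.mul_apply]
    exact (Equiv.sum_comp e _).symm

theorem tensor_iso (c : SkewSet F ι) (d : SkewSet F κ) :
    IsAlgIso F (SkewMatrix c ⊗[F] SkewMatrix d) (SkewMatrix (c.tensor d)) := by
  let e : Matrix ι ι F ⊗[F] Matrix κ κ F ≃ₗ[F] Matrix (ι × κ) (ι × κ) F :=
    (kroneckerTMulLinearEquiv ι ι κ κ F F F F).trans (TensorProduct.lid F F).mapMatrix
  let e' : SkewMatrix c ⊗[F] SkewMatrix d ≃ₗ[F] SkewMatrix (c.tensor d) := e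
  have he (x : SkewMatrix c) (y : SkewMatrix d) (p q) :
      e' (x ⊗ₜ y) p q = x p.1 q.1 * y p.2 q.2 := by
    change e ((x : Matrix ι ι F) ⊗ₜ (y : Matrix κ κ F)) p q = _
    simp [e]
    rfl
  refine ⟨e', IsAlgIso.map_mul_of_tmul e' fun a b a' b' => ?_⟩
  ext p q
  rw [he, SkewMatrix.mul_apply, SkewMatrix.mul_apply, SkewMatrix.mul_apply, Finset.sum_mul_sum,
    Fintype.sum_prod_type]
  refine Finset.sum_congr rfl fun i _ => Finset.sum_congr rfl fun j _ => ?_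
  rw [he, he]
  simp only [tensor]
  ring

/-- The trivial skew set of degree one. -/
def unit (F : Type u) [Field F] : SkewSet F (Fin 1) where
  coeff _ _ _ := 1
  left_one _ _ := rfl
  right_one _ _ := rfl

end SkewSet

namespace IsSkewEquivalent

variable {F}
variable {A A' B B' C : Type*}
  [NonAssocRing A] [Module F A] [SMulCommClass F A A] [IsScalarTower F A A]
  [NonAssocRing A'] [Module F A'] [SMulCommClass F A' A'] [IsScalarTower F A' A']
  [NonAssocRing B] [Module F B] [SMulCommClass F B B] [IsScalarTower F B B]
  [NonAssocRing B'] [Module F B'] [SMulCommClass F B' B'] [IsScalarTower F B' B']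
  [NonAssocRing C] [Module F C] [SMulCommClass F C C] [IsScalarTower F C C]

theorem of_iso (h : IsAlgIso F A B) : IsSkewEquivalent F A B :=
  ⟨1, 1, SkewSet.unit F, SkewSet.unit F, one_pos, one_pos, h.tensor .refl⟩

theorem symm (h : IsSkewEquivalent F A B) : IsSkewEquivalent F B A := by
  obtain ⟨n, n', c, c', hn, hn', e⟩ := h
  exact ⟨n', n, c', c, hn', hn, e.symm⟩

theorem exists_tensor {n m : ℕ} (c : SkewSet F (Fin n)) (d : SkewSet F (Fin m)) :
    ∃ s : SkewSet F (Fin (n * m)), IsAlgIso F (SkewMatrix c ⊗[F] SkewMatrix d) (SkewMatrix s) :=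
  ⟨(c.tensor d).reindex finProdFinEquiv.symm, (c.tensor_iso d).trans (SkewSet.reindex_iso _ _)⟩

theorem trans (h : IsSkewEquivalent F A B) (h' : IsSkewEquivalent F B C) :
    IsSkewEquivalent F A C := by
  obtain ⟨n, n', c, c', hn, hn', e⟩ := h
  obtain ⟨m, m', d, d', hm, hm', e'⟩ := h'
  obtain ⟨s, hs⟩ := exists_tensor c d
  obtain ⟨s', hs'⟩ := exists_tensor d' c'
  refine ⟨_, _, s, s', Nat.mul_pos hn hm, Nat.mul_pos hm' hn', ?_⟩
  have h1 : IsAlgIso F (A ⊗[F] SkewMatrix s) ((A ⊗[F] SkewMatrix c) ⊗[F] SkewMatrix d) :=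
    (IsAlgIso.refl.tensor hs.symm).trans IsAlgIso.assoc.symm
  have h2 : IsAlgIso F ((A ⊗[F] SkewMatrix c) ⊗[F] SkewMatrix d)
      ((B ⊗[F] SkewMatrix c') ⊗[F] SkewMatrix d) := e.tensor .refl
  have h3 : IsAlgIso F ((B ⊗[F] SkewMatrix c') ⊗[F] SkewMatrix d)
      (B ⊗[F] (SkewMatrix d ⊗[F] SkewMatrix c')) :=
    IsAlgIso.assoc.trans (IsAlgIso.refl.tensor IsAlgIso.comm)
  have h4 : IsAlgIso F (B ⊗[F] (SkewMatrix d ⊗[F] SkewMatrix c'))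
      ((B ⊗[F] SkewMatrix d) ⊗[F] SkewMatrix c') := IsAlgIso.assoc.symm
  have h5 : IsAlgIso F ((B ⊗[F] SkewMatrix d) ⊗[F] SkewMatrix c')
      ((C ⊗[F] SkewMatrix d') ⊗[F] SkewMatrix c') := e'.tensor .refl
  have h6 : IsAlgIso F ((C ⊗[F] SkewMatrix d') ⊗[F] SkewMatrix c') (C ⊗[F] SkewMatrix s') :=
    IsAlgIso.assoc.trans (IsAlgIso.refl.tensor hs')
  exact h1.trans (h2.trans (h3.trans (h4.trans (h5.trans h6))))

theorem tensor (h : IsSkewEquivalent F A A') (h' : IsSkewEquivalent F B B') :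
    IsSkewEquivalent F (A ⊗[F] B) (A' ⊗[F] B') := by
  obtain ⟨n, n', c, c', hn, hn', e⟩ := h
  obtain ⟨m, m', d, d', hm, hm', e'⟩ := h'
  obtain ⟨s, hs⟩ := exists_tensor c d
  obtain ⟨s', hs'⟩ := exists_tensor c' d'
  refine ⟨_, _, s, s', Nat.mul_pos hn hm, Nat.mul_pos hn' hm', ?_⟩
  have h1 : IsAlgIso F ((A ⊗[F] B) ⊗[F] SkewMatrix s)
      ((A ⊗[F] SkewMatrix c) ⊗[F] (B ⊗[F] SkewMatrix d)) :=
    (IsAlgIso.refl.tensor hs.symm).trans IsAlgIso.tensorComm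
  have h2 : IsAlgIso F ((A' ⊗[F] B') ⊗[F] SkewMatrix s')
      ((A' ⊗[F] SkewMatrix c') ⊗[F] (B' ⊗[F] SkewMatrix d')) :=
    (IsAlgIso.refl.tensor hs'.symm).trans IsAlgIso.tensorComm
  exact h1.trans ((e.tensor e').trans h2.symm)

end IsSkewEquivalent

end Iso

/-! ## Minimally faithful modules -/

/-- A module is minimally faithful if it is faithful and none of its proper sections (quotients of
submodules) is faithful. -/
def IsMinimallyFaithful (R : Type*) (M : Type*) [Ring R] [AddCommGroup M] [Module R M] : Prop :=
  FaithfulSMul R M ∧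
    ∀ (N : Submodule R M) (P : Submodule R N), FaithfulSMul R (N ⧸ P) → N = ⊤ ∧ P = ⊥

section MinimallyFaithful

variable {R M : Type*} [CommRing R] [AddCommGroup M] [Module R M]

theorem exists_smul_injective [IsArtinianRing R] [IsReduced R] [FaithfulSMul R M] :
    ∃ v : M, Function.Injective fun r : R => r • v := by
  classical
  have := Fintype.ofFinite (MaximalSpectrum R)
  let E := IsArtinianRing.equivPi R
  let e : MaximalSpectrum R → R := fun m => E.symm (Pi.single m 1)
  have he (m) : E (e m) = Pi.single m 1 := E.apply_symm_apply _
  have hne (m) : ∃ v : M, e m • v ≠ 0 := by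
    by_contra! h
    have : e m = 0 := FaithfulSMul.eq_of_smul_eq_smul (α := M) fun v => by simp [h v]
    have h1 := congrFun ((he m).symm.trans (by rw [this, map_zero])) m
    rw [Pi.single_eq_same, Pi.zero_apply] at h1
    exact one_ne_zero h1
  choose v hv using hne
  have hmul (m m' : MaximalSpectrum R) : e m * e m' = if m = m' then e m else 0 := by
    apply E.injective
    rw [map_mul, he, he]
    split_ifs with h
    · subst h
      rw [he, ← Pi.single_mul, one_mul]
    · rw [map_zero]
      funext i
      by_cases hi : i = m
      · subst hi; simp [Pi.single_eq_of_ne h]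
      · simp [Pi.single_eq_of_ne hi]
  refine ⟨∑ m, e m • v m, fun r s hrs => sub_eq_zero.1 ?_⟩
  have h0 : (r - s) • ∑ m, e m • v m = 0 := by
    rw [sub_smul]; exact sub_eq_zero.2 hrs
  set t := r - s
  apply E.injective
  rw [map_zero]
  funext m
  by_contra hm
  rw [Pi.zero_apply] at hm
  have hem : t • e m • v m = 0 := by
    have h1 : e m • t • ∑ m, e m • v m = 0 := by rw [h0, smul_zero]
    rw [smul_comm, Finset.smul_sum] at h1
    simpa [smul_smul, hmul, ← mul_assoc] using h1
  let := Ideal.Quotient.field m.asIdeal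
  have hinv : e m = E.symm (Pi.single m (E t m)⁻¹) * (t * e m) := by
    apply E.injective
    rw [map_mul, map_mul, he, E.apply_symm_apply]
    funext m'
    by_cases h : m' = m
    · subst h
      simp only [Pi.mul_apply, Pi.single_eq_same, mul_one]
      exact (inv_mul_cancel₀ hm).symm
    · simp [Pi.single_eq_of_ne h]
  apply hv m
  rw [hinv, mul_smul, mul_smul, hem, smul_zero]

theorem isMinimallyFaithful_iff [IsArtinianRing R] [IsReduced R] :
    IsMinimallyFaithful R M ↔ ∃ v : M, Function.Bijective fun r : R => r • v := by
  constructor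
  · rintro ⟨hf, hmin⟩
    obtain ⟨v, hv⟩ := exists_smul_injective (R := R) (M := M)
    refine ⟨v, hv, ?_⟩
    have hN : FaithfulSMul R (R ∙ v ⧸ (⊥ : Submodule R (R ∙ v))) := by
      refine ⟨fun {r s} h => hv ?_⟩
      have h1 := h (Submodule.Quotient.mk ⟨v, Submodule.mem_span_singleton_self v⟩)
      rw [← Submodule.Quotient.mk_smul, ← Submodule.Quotient.mk_smul, Submodule.Quotient.eq,
        Submodule.mem_bot, sub_eq_zero] at h1
      exact congrArg Subtype.val h1
    have htop := (hmin _ _ hN).1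
    intro x
    have hx : x ∈ R ∙ v := htop ▸ Submodule.mem_top
    exact Submodule.mem_span_singleton.1 hx
  · rintro ⟨v, hinj, hsurj⟩
    refine ⟨⟨fun h => hinj (h v)⟩, fun N P hNP => ?_⟩
    have kill (r : R) (h : ∀ x : N, r • x ∈ P) : r = 0 := by
      refine hNP.eq_of_smul_eq_smul fun y => ?_
      obtain ⟨x, rfl⟩ := Submodule.Quotient.mk_surjective _ y
      rw [zero_smul, ← Submodule.Quotient.mk_smul, Submodule.Quotient.mk_eq_zero]
      exact h x
    let I : Ideal R := N.comap (LinearMap.toSpanSingleton R M v)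
    have hI (r : R) : r ∈ I ↔ r • v ∈ N := by
      simp [I, LinearMap.toSpanSingleton_apply]
    have : IsSemisimpleRing R := IsArtinianRing.isSemisimpleRing_of_isReduced R
    have : ComplementedLattice (Submodule R R) := this.toComplementedLattice
    obtain ⟨J, hJ⟩ : ∃ J : Submodule R R, IsCompl I J := exists_isCompl I
    have hJ0 : J = ⊥ := by
      rw [eq_bot_iff]
      intro j hj
      rw [Submodule.mem_bot]
      refine kill j fun x => ?_
      obtain ⟨r, hr⟩ := hsurj x
      have hrI : r ∈ I := (hI r).2 (by change r • v = x at hr; rw [hr]; exact x.2)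
      have : j * r ∈ I ⊓ J := ⟨I.mul_mem_left _ hrI, Ideal.mul_mem_right _ J hj⟩
      rw [hJ.inf_eq_bot, Submodule.mem_bot] at this
      have hx : j • x = 0 := by
        apply Subtype.ext
        change j • (x : M) = 0
        rw [← hr]
        change j • r • v = 0
        rw [smul_smul, this, zero_smul]
      rw [hx]; exact P.zero_mem
    have hItop : I = ⊤ := by simpa [hJ0] using hJ.sup_eq_top
    have hN : N = ⊤ := by
      rw [eq_top_iff]
      intro x _
      obtain ⟨r, rfl⟩ := hsurj x
      exact (hI r).1 (hItop ▸ Submodule.mem_top)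
    refine ⟨hN, ?_⟩
    rw [eq_bot_iff]
    intro p hp
    obtain ⟨r, hr⟩ := hsurj p
    change r • v = p at hr
    have hr0 : r = 0 := by
      refine kill r fun x => ?_
      obtain ⟨s, hs⟩ := hsurj x
      have : r • x = s • p := by
        apply Subtype.ext
        change r • (x : M) = s • (p : M)
        rw [← hs, ← hr]
        exact smul_comm r s v
      rw [this]
      exact P.smul_mem s hp
    rw [Submodule.mem_bot]
    apply Subtype.ext
    rw [← hr, hr0, zero_smul]; rfl

end MinimallyFaithful

/-! ## Semiassociative algebras -/

/-- The nucleus: elements `x` with `(x, A, A) = (A, x, A) = (A, A, x) = 0`. -/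
def nucleus (A : Type*) [NonUnitalNonAssocRing A] : Set A :=
  {x | ∀ a b : A, associator x a b = 0 ∧ associator a x b = 0 ∧ associator a b x = 0}

/-- An embedding of the unital algebra `K` as a subalgebra of the nucleus of `A`. -/
structure NuclearEmbedding (F : Type*) (K : Type*) (A : Type*) [Field F] [CommRing K] [Algebra F K]
    [NonAssocRing A] [Module F A] where
  toLinearMap : K →ₗ[F] A
  map_one : toLinearMap 1 = 1
  map_mul : ∀ k l, toLinearMap (k * l) = toLinearMap k * toLinearMap l
  injective : Function.Injective toLinearMap
  mem_nucleus : ∀ k, toLinearMap k ∈ nucleus A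

namespace NuclearEmbedding

variable {F K A : Type*} [Field F] [CommRing K] [Algebra F K] [NonAssocRing A] [Module F A]

instance : FunLike (NuclearEmbedding F K A) K A where
  coe φ := φ.toLinearMap
  coe_injective φ ψ h := by
    cases φ; cases ψ; congr; exact DFunLike.coe_injective h

variable (φ : NuclearEmbedding F K A)

theorem mul_assoc_left (k : K) (a b : A) : φ k * a * b = φ k * (a * b) :=
  sub_eq_zero.1 (φ.mem_nucleus k a b).1

theorem mul_assoc_mid (k : K) (a b : A) : a * φ k * b = a * (φ k * b) :=
  sub_eq_zero.1 (φ.mem_nucleus k a b).2.1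

theorem mul_assoc_right (k : K) (a b : A) : a * b * φ k = a * (b * φ k) :=
  sub_eq_zero.1 (φ.mem_nucleus k a b).2.2

variable [SMulCommClass F A A] [IsScalarTower F A A]

/-- `k` acts by `a ↦ k * a`. -/
def leftAction : K →ₐ[F] Module.End F A :=
  AlgHom.ofLinearMap ((LinearMap.mul F A).comp φ.toLinearMap)
    (by ext a; simp [φ.map_one])
    (fun k l => by
      ext a
      simp only [LinearMap.comp_apply, φ.map_mul, LinearMap.mul_apply', Module.End.mul_apply]
      exact φ.mul_assoc_left k _ a)

/-- `k` acts by `a ↦ a * k`. -/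
def rightAction : K →ₐ[F] Module.End F A :=
  AlgHom.ofLinearMap ((LinearMap.mul F A).flip.comp φ.toLinearMap)
    (by ext a; simp [φ.map_one])
    (fun k l => by
      ext a
      rw [mul_comm k l]
      simp only [LinearMap.comp_apply, φ.map_mul, LinearMap.mul_apply', Module.End.mul_apply,
        LinearMap.flip_apply]
      exact (φ.mul_assoc_mid l a _).symm)

theorem commute_actions (k l : K) : Commute (φ.leftAction k) (φ.rightAction l) :=
  LinearMap.ext fun a => (φ.mul_assoc_left k a (φ l)).symm

/-- The action `(k ⊗ l) a = k a l` of `K ⊗ K` on `A`. -/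
noncomputable def biAction : K ⊗[F] K →ₐ[F] Module.End F A :=
  Algebra.TensorProduct.lift φ.leftAction φ.rightAction φ.commute_actions

theorem biAction_tmul (k l : K) (a : A) : φ.biAction (k ⊗ₜ l) a = φ k * (a * φ l) := by
  rw [biAction, Algebra.TensorProduct.lift_tmul]
  rfl

/-- `A` as a module over `K ⊗ K`. -/
noncomputable abbrev bimodule : Module (K ⊗[F] K) A :=
  Module.compHom A φ.biAction.toRingHom

end NuclearEmbedding

/-- A semiassociative algebra over `F`: finite dimensional, with center `F`, and minimally
faithful over `K ⊗ K` for some étale subalgebra `K` of the nucleus. -/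
structure IsSemiassociative (F : Type u) (A : Type v) [Field F] [NonAssocRing A] [Module F A]
    [SMulCommClass F A A] [IsScalarTower F A A] : Prop where
  finite : Module.Finite F A
  nontrivial : Nontrivial A
  center_eq : Set.center A = Set.range fun r : F => r • (1 : A)
  exists_etale : ∃ (K : Type v) (_ : CommRing K) (_ : Algebra F K) (_ : Algebra.Etale F K)
    (φ : NuclearEmbedding F K A),
    @IsMinimallyFaithful (K ⊗[F] K) A _ _ φ.bimodule

section Semiassociative

variable {F : Type u} [Field F]

theorem etale_tensor (K L : Type*) [CommRing K] [Algebra F K] [CommRing L] [Algebra F L]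
    [Algebra.Etale F K] [Algebra.Etale F L] : Algebra.Etale F (K ⊗[F] L) :=
  Algebra.Etale.comp F K (K ⊗[F] L)

theorem minimallyFaithful_iff_of_etale {K A : Type*} [CommRing K] [Algebra F K] [Algebra.Etale F K]
    [NonAssocRing A] [Module F A] [SMulCommClass F A A] [IsScalarTower F A A]
    (φ : NuclearEmbedding F K A) :
    @IsMinimallyFaithful (K ⊗[F] K) A _ _ φ.bimodule ↔
      ∃ v : A, Function.Bijective fun r : K ⊗[F] K => φ.biAction r v := by
  have := etale_tensor (F := F) K K
  have : Module.Finite F (K ⊗[F] K) := Algebra.FormallyUnramified.finite_of_free F _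
  have : IsReduced (K ⊗[F] K) := Algebra.FormallyUnramified.isReduced_of_field F _
  have : IsArtinianRing (K ⊗[F] K) := IsArtinianRing.of_finite F _
  let := φ.bimodule
  exact isMinimallyFaithful_iff (R := K ⊗[F] K) (M := A)

variable {A B : Type*}
  [NonAssocRing A] [Module F A] [SMulCommClass F A A] [IsScalarTower F A A]
  [NonAssocRing B] [Module F B] [SMulCommClass F B B] [IsScalarTower F B B]

theorem smul_one_mem_center (r : F) : r • (1 : A) ∈ Set.center A := by
  rw [Set.mem_center_iff]
  refine ⟨fun a => ?_, fun a b => ?_, fun a b => ?_⟩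
  · simp [Commute, SemiconjBy]
  · simp [smul_mul_assoc]
  · simp [mul_smul_comm]

theorem IsSemiassociative.self : IsSemiassociative F F where
  finite := inferInstance
  nontrivial := inferInstance
  center_eq := by
    apply Set.Subset.antisymm
    · intro z _; exact ⟨z, by simp⟩
    · rintro _ ⟨r, rfl⟩; exact smul_one_mem_center r
  exists_etale := by
    let φ : NuclearEmbedding F F F :=
      { toLinearMap := LinearMap.id
        map_one := rfl
        map_mul := fun _ _ => rfl
        injective := fun _ _ h => h
        mem_nucleus := fun k a b => by simp [associator, mul_assoc] }
    refine ⟨F, inferInstance, inferInstance, inferInstance, φ, ?_⟩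
    refine (minimallyFaithful_iff_of_etale φ).2 ⟨1, ?_⟩
    convert (TensorProduct.lid F F).bijective using 1
    funext r
    induction r with
    | zero => simp
    | add x y hx hy => simp [hx, hy]
    | tmul k l => rw [φ.biAction_tmul]; simp; rfl

theorem center_tensor (hA : Set.center A ⊆ Set.range fun r : F => r • (1 : A))
    (hB : Set.center B ⊆ Set.range fun r : F => r • (1 : B)) [Nontrivial A] :
    Set.center (A ⊗[F] B) ⊆ Set.range fun r : F => r • (1 : A ⊗[F] B) := by
  classical
  intro z hz
  rw [Set.mem_center_iff] at hz
  let b := Module.Free.chooseBasis F B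
  let E := TensorProduct.equivFinsuppOfBasisRight (M := A) b
  have hE (a : A) (y : B) (i) : E (a ⊗ₜ y) i = b.repr y i • a := by
    simp [E, TensorProduct.equivFinsuppOfBasisRight_apply_tmul]
  have hr (x : A ⊗[F] B) (a : A) (i) : E (x * (a ⊗ₜ 1)) i = E x i * a := by
    induction x with
    | zero => simp
    | add x y hx hy => simp [add_mul, hx, hy]
    | tmul a' y => simp [hE, smul_mul_assoc]
  have hl (x : A ⊗[F] B) (a : A) (i) : E ((a ⊗ₜ 1) * x) i = a * E x i := by
    induction x with
    | zero => simp
    | add x y hx hy => simp [mul_add, hx, hy]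
    | tmul a' y => simp [hE, mul_smul_comm]
  have hcent (i) : E z i ∈ Set.center A := by
    rw [Set.mem_center_iff]
    refine ⟨fun a => ?_, fun a a' => ?_, fun a a' => ?_⟩
    · have h := hz.comm (a ⊗ₜ 1)
      have h1 := congrArg (fun y => E y i) h.eq
      rw [commute_iff_eq]
      simpa only [hr, hl] using h1
    · have h := hz.left_assoc (a ⊗ₜ 1) (a' ⊗ₜ 1)
      rw [Algebra.TensorProduct.tmul_mul_tmul, one_mul] at h
      have h1 := congrArg (fun y => E y i) h
      simpa only [hr, hl] using h1
    · have h := hz.right_assoc (a ⊗ₜ 1) (a' ⊗ₜ 1)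
      rw [Algebra.TensorProduct.tmul_mul_tmul, one_mul] at h
      have h1 := congrArg (fun y => E y i) h
      simpa only [hr, hl] using h1
  choose f hf using fun i => hA (hcent i)
  -- `z = 1 ⊗ y`
  obtain ⟨y, hy⟩ : ∃ y : B, z = 1 ⊗ₜ y := by
    refine ⟨∑ i ∈ (E z).support, f i • b i, E.injective (Finsupp.ext fun i => ?_)⟩
    rw [hE, ← hf i]
    simp only [map_sum, map_smul, Module.Basis.repr_self, Finsupp.coe_finsetSum,
      Finset.sum_apply, Finsupp.smul_apply, Finsupp.single_apply, smul_eq_mul, mul_ite, mul_one,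
      mul_zero, Finset.sum_ite_eq']
    split_ifs with h
    · rfl
    · rw [zero_smul, ← Finsupp.notMem_support_iff.1 h]
      exact hf i
  have hinj : Function.Injective fun y : B => (1 : A) ⊗ₜ[F] y := by
    intro y y' h
    apply b.repr.injective
    ext i
    have h1 := congrArg (fun t => E t i) h
    simp only [hE] at h1
    exact smul_left_injective F (one_ne_zero : (1 : A) ≠ 0) h1
  subst hy
  have hyc : y ∈ Set.center B := by
    rw [Set.mem_center_iff]
    refine ⟨fun a => hinj ?_, fun a a' => hinj ?_, fun a a' => hinj ?_⟩
    · simpa using (hz.comm (1 ⊗ₜ a)).eq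
    · simpa using hz.left_assoc (1 ⊗ₜ a) (1 ⊗ₜ a')
    · simpa using hz.right_assoc (1 ⊗ₜ a) (1 ⊗ₜ a')
  obtain ⟨r, rfl⟩ := hB hyc
  exact ⟨r, by simp [Algebra.TensorProduct.one_def]⟩

theorem NuclearEmbedding.tmul_mem_nucleus {x : A} {y : B} (hx : x ∈ nucleus A)
    (hy : y ∈ nucleus B) : x ⊗ₜ[F] y ∈ nucleus (A ⊗[F] B) := by
  have hx1 (a b) : x * a * b = x * (a * b) := sub_eq_zero.1 (hx a b).1
  have hx2 (a b) : a * x * b = a * (x * b) := sub_eq_zero.1 (hx a b).2.1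
  have hx3 (a b) : a * b * x = a * (b * x) := sub_eq_zero.1 (hx a b).2.2
  have hy1 (a b) : y * a * b = y * (a * b) := sub_eq_zero.1 (hy a b).1
  have hy2 (a b) : a * y * b = a * (y * b) := sub_eq_zero.1 (hy a b).2.1
  have hy3 (a b) : a * b * y = a * (b * y) := sub_eq_zero.1 (hy a b).2.2
  intro s t
  simp only [associator_apply, sub_eq_zero]
  induction s with
  | zero => simp
  | add s s' h h' => simp [mul_add, add_mul, h, h']
  | tmul a b =>
    induction t with
    | zero => simp
    | add s s' h h' =>
      exact ⟨by rw [mul_add, mul_add, mul_add, h.1, h'.1],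
        by rw [mul_add, mul_add, mul_add, h.2.1, h'.2.1],
        by rw [mul_add, add_mul, add_mul, mul_add, h.2.2, h'.2.2]⟩
    | tmul a' b' => simp [hx1, hx2, hx3, hy1, hy2, hy3]

theorem nucleus_add {x y : A} (hx : x ∈ nucleus A) (hy : y ∈ nucleus A) : x + y ∈ nucleus A := by
  intro a b
  obtain ⟨h1, h2, h3⟩ := hx a b
  obtain ⟨g1, g2, g3⟩ := hy a b
  simp only [associator_apply, sub_eq_zero] at *
  simp [mul_add, add_mul, *]

/-- Tensor product of embeddings into the nuclei. -/
noncomputable def NuclearEmbedding.tensor {K L : Type*} [CommRing K] [Algebra F K] [CommRing L]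
    [Algebra F L] (φ : NuclearEmbedding F K A) (ψ : NuclearEmbedding F L B) :
    NuclearEmbedding F (K ⊗[F] L) (A ⊗[F] B) where
  toLinearMap := TensorProduct.map φ.toLinearMap ψ.toLinearMap
  map_one := by simp [Algebra.TensorProduct.one_def, φ.map_one, ψ.map_one]
  map_mul x y := by
    induction x with
    | zero => simp
    | add s s' h h' => simp [add_mul, h, h']
    | tmul a b =>
      induction y with
      | zero => simp
      | add s s' h h' => simp [mul_add, h, h']
      | tmul a' b' => simp [φ.map_mul, ψ.map_mul]
  injective := by
    have h1 : Function.Injective (φ.toLinearMap.rTensor L) :=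
      Module.Flat.rTensor_preserves_injective_linearMap _ φ.injective
    have h2 : Function.Injective (ψ.toLinearMap.lTensor A) :=
      Module.Flat.lTensor_preserves_injective_linearMap _ ψ.injective
    have : TensorProduct.map φ.toLinearMap ψ.toLinearMap =
        (ψ.toLinearMap.lTensor A).comp (φ.toLinearMap.rTensor L) :=
      (LinearMap.lTensor_comp_rTensor _ _ _).symm
    rw [this]
    exact h2.comp h1
  mem_nucleus x := by
    induction x with
    | zero => intro a b; simp [associator_apply]
    | add s s' h h' => rw [map_add]; exact nucleus_add h h'
    | tmul k l => exact tmul_mem_nucleus (φ.mem_nucleus k) (ψ.mem_nucleus l)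

end Semiassociative

theorem IsSemiassociative.tensor {F : Type u} {A B : Type v} [Field F]
    [NonAssocRing A] [Module F A] [SMulCommClass F A A] [IsScalarTower F A A]
    [NonAssocRing B] [Module F B] [SMulCommClass F B B] [IsScalarTower F B B]
    (hA : IsSemiassociative F A) (hB : IsSemiassociative F B) :
    IsSemiassociative F (A ⊗[F] B) := by
  obtain ⟨fA, nA, cA, K, _, _, _, φ, hφ⟩ := hA
  obtain ⟨fB, nB, cB, L, _, _, _, ψ, hψ⟩ := hB
  refine ⟨inferInstance, inferInstance, ?_, K ⊗[F] L, inferInstance, inferInstance,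
    etale_tensor K L, φ.tensor ψ, ?_⟩
  · apply Set.Subset.antisymm
    · exact center_tensor cA.subset cB.subset
    · rintro _ ⟨r, rfl⟩; exact smul_one_mem_center r
  · have := etale_tensor (F := F) K L
    obtain ⟨v, hv⟩ := (minimallyFaithful_iff_of_etale φ).1 hφ
    obtain ⟨w, hw⟩ := (minimallyFaithful_iff_of_etale ψ).1 hψ
    refine (minimallyFaithful_iff_of_etale (φ.tensor ψ)).2 ⟨v ⊗ₜ w, ?_⟩
    let e : K ⊗[F] K ≃ₗ[F] A :=
      LinearEquiv.ofBijective ((LinearMap.applyₗ v).comp φ.biAction.toLinearMap) hv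
    let f : L ⊗[F] L ≃ₗ[F] B :=
      LinearEquiv.ofBijective ((LinearMap.applyₗ w).comp ψ.biAction.toLinearMap) hw
    let g := (TensorProduct.tensorTensorTensorComm F K L K L).trans (TensorProduct.congr e f)
    convert g.bijective using 1
    funext r
    have key : ((LinearMap.applyₗ (v ⊗ₜ w)).comp (φ.tensor ψ).biAction.toLinearMap) =
        g.toLinearMap := by
      ext k l k' l'
      change (φ.tensor ψ).biAction ((k ⊗ₜ l) ⊗ₜ (k' ⊗ₜ l')) (v ⊗ₜ w) =
        φ.biAction (k ⊗ₜ k') v ⊗ₜ ψ.biAction (l ⊗ₜ l') w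
      rw [NuclearEmbedding.biAction_tmul, NuclearEmbedding.biAction_tmul,
        NuclearEmbedding.biAction_tmul]
      change (φ k ⊗ₜ ψ l) * ((v ⊗ₜ w) * (φ k' ⊗ₜ ψ l')) = _
      simp
    exact LinearMap.congr_fun key r

/-! ## The semiassociative Brauer monoid -/

/-- The semiassociative algebras over `F`. -/
structure SemiassocAlg (F : Type u) [Field F] where
  carrier : Type u
  [ring : NonAssocRing carrier]
  [module : Module F carrier]
  [smulComm : SMulCommClass F carrier carrier]
  [tower : IsScalarTower F carrier carrier]
  isSemiassociative : IsSemiassociative F carrier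

namespace SemiassocAlg

instance (F : Type u) [Field F] : CoeSort (SemiassocAlg F) (Type u) := ⟨SemiassocAlg.carrier⟩

attribute [instance] ring module smulComm tower

variable (F : Type u) [Field F]

/-- Brauer equivalence of semiassociative algebras. -/
instance setoid : Setoid (SemiassocAlg F) where
  r A B := IsSkewEquivalent F A B
  iseqv :=
    { refl := fun _ => .of_iso .refl
      symm := fun h => h.symm
      trans := fun h h' => h.trans h' }

variable {F}

/-- The tensor product of semiassociative algebras. -/
noncomputable def tensor (A B : SemiassocAlg F) : SemiassocAlg F where
  carrier := A ⊗[F] B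
  isSemiassociative := A.isSemiassociative.tensor B.isSemiassociative

variable (F)

/-- The field `F` as a semiassociative algebra over itself. -/
def unit : SemiassocAlg F where
  carrier := F
  isSemiassociative := .self

end SemiassocAlg

/-- The semiassociative Brauer monoid. -/
def SemiassocBrauerMonoid (F : Type u) [Field F] : Type (u + 1) :=
  Quotient (SemiassocAlg.setoid F)

namespace SemiassocBrauerMonoid

variable {F : Type u} [Field F]

/-- The class of a semiassociative algebra. -/
def mk (A : SemiassocAlg F) : SemiassocBrauerMonoid F :=
  Quotient.mk (SemiassocAlg.setoid F) A

/-- The product is induced by the tensor product, and the identity is the class of `F`. -/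
noncomputable instance : CommMonoid (SemiassocBrauerMonoid F) where
  mul := Quotient.map₂ SemiassocAlg.tensor fun _ _ h _ _ h' => IsSkewEquivalent.tensor h h'
  one := mk (SemiassocAlg.unit F)
  mul_assoc := by
    rintro ⟨A⟩ ⟨B⟩ ⟨C⟩
    exact Quotient.sound (.of_iso (IsAlgIso.assoc (A := A) (B := B) (C := C)))
  one_mul := by
    rintro ⟨A⟩
    exact Quotient.sound (.of_iso (IsAlgIso.lid (A := A)))
  mul_one := by
    rintro ⟨A⟩
    exact Quotient.sound (.of_iso (IsAlgIso.comm.trans (IsAlgIso.lid (A := A))))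
  mul_comm := by
    rintro ⟨A⟩ ⟨B⟩
    exact Quotient.sound (.of_iso (IsAlgIso.comm (A := A) (B := B)))

end SemiassocBrauerMonoid

/-! ## The classical Brauer group as a monoid -/

section Classical

variable {F : Type u} [Field F]

theorem one_mem_span_of_ne_zero {A : Type*} [Ring A] [IsSimpleRing A] {a : A} (ha : a ≠ 0)
    {p : A → Prop} (h0 : p 0) (hadd : ∀ x y, p x → p y → p (x + y))
    (hmul : ∀ s t, p (s * a * t)) : p 1 := by
  let H : AddSubgroup A := AddSubgroup.closure {y | ∃ s t, y = s * a * t}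
  let I : TwoSidedIdeal A := TwoSidedIdeal.mk' {x | x ∈ H}
    H.zero_mem (fun h h' => H.add_mem h h') (fun h => H.neg_mem h)
    (fun {x y} hy => by
      refine AddSubgroup.closure_induction (p := fun y _ => x * y ∈ AddSubgroup.closure _)
        ?_ ?_ ?_ ?_ hy
      · rintro _ ⟨s, t, rfl⟩
        exact AddSubgroup.subset_closure ⟨x * s, t, by simp [mul_assoc]⟩
      · rw [mul_zero]; exact AddSubgroup.zero_mem _
      · intro _ _ _ _ h h'; rw [mul_add]; exact AddSubgroup.add_mem _ h h'
      · intro _ _ h; rw [mul_neg]; exact AddSubgroup.neg_mem _ h)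
    (fun {y x} hy => by
      refine AddSubgroup.closure_induction (p := fun y _ => y * x ∈ AddSubgroup.closure _)
        ?_ ?_ ?_ ?_ hy
      · rintro _ ⟨s, t, rfl⟩
        exact AddSubgroup.subset_closure ⟨s, t * x, by simp [mul_assoc]⟩
      · rw [zero_mul]; exact AddSubgroup.zero_mem _
      · intro _ _ _ _ h h'; rw [add_mul]; exact AddSubgroup.add_mem _ h h'
      · intro _ _ h; rw [neg_mul]; exact AddSubgroup.neg_mem _ h)
  have hI (x : A) : x ∈ I ↔ x ∈ AddSubgroup.closure {y | ∃ s t, y = s * a * t} :=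
    TwoSidedIdeal.mem_mk' ..
  have haI : a ∈ I := (hI a).2 (AddSubgroup.subset_closure ⟨1, 1, by simp⟩)
  have htop : I = ⊤ := (eq_bot_or_eq_top I).resolve_left fun h => ha (by
    rw [h] at haI; exact (TwoSidedIdeal.mem_bot A).1 haI)
  have h1 : (1 : A) ∈ I := by rw [htop]; trivial
  suffices h : ∀ x ∈ AddSubgroup.closure {y | ∃ s t, y = s * a * t}, p x ∧ p (-x) from
    (h 1 ((hI 1).1 h1)).1
  intro x hx
  refine AddSubgroup.closure_induction (p := fun y _ => p y ∧ p (-y)) ?_ ?_ ?_ ?_ hx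
  · rintro _ ⟨s, t, rfl⟩
    refine ⟨hmul s t, ?_⟩
    have := hmul (-s) t
    simpa using this
  · simpa using h0
  · intro x y _ _ h h'
    refine ⟨hadd _ _ h.1 h'.1, ?_⟩
    rw [neg_add]
    exact hadd _ _ h.2 h'.2
  · intro x _ h
    exact ⟨h.2, by simpa using h.1⟩

theorem isSimpleRing_tensor (A B : Type*) [Ring A] [Algebra F A] [Ring B] [Algebra F B]
    [Algebra.IsCentral F A] [IsSimpleRing A] [IsSimpleRing B] : IsSimpleRing (A ⊗[F] B) := by
  classical
  have : Nontrivial (A ⊗[F] B) := inferInstance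
  refine IsSimpleRing.of_eq_bot_or_eq_top fun I => or_iff_not_imp_left.2 fun hI => ?_
  let b := Module.Free.chooseBasis F B
  let E := TensorProduct.equivFinsuppOfBasisRight (M := A) b
  have hE (a : A) (y : B) (i) : E (a ⊗ₜ y) i = b.repr y i • a := by
    simp [E, TensorProduct.equivFinsuppOfBasisRight_apply_tmul]
  have hr (x : A ⊗[F] B) (a : A) (i) : E (x * (a ⊗ₜ 1)) i = E x i * a := by
    induction x with
    | zero => simp
    | add x y hx hy => simp [add_mul, hx, hy]
    | tmul a' y => simp [hE]
  have hl (x : A ⊗[F] B) (a : A) (i) : E ((a ⊗ₜ 1) * x) i = a * E x i := by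
    induction x with
    | zero => simp
    | add x y hx hy => simp [mul_add, hx, hy]
    | tmul a' y => simp [hE]
  -- a nonzero element of minimal support
  obtain ⟨x₀, hx₀I, hx₀⟩ : ∃ x ∈ I, x ≠ 0 := by
    by_contra! h
    exact hI (eq_bot_iff.2 fun x hx => (TwoSidedIdeal.mem_bot _).2 (h x hx))
  obtain ⟨x, ⟨hxI, hx⟩, hmin⟩ := exists_minimalFor_of_wellFoundedLT
    (fun x : A ⊗[F] B => x ∈ I ∧ x ≠ 0) (fun x => (E x).support) ⟨x₀, hx₀I, hx₀⟩
  have hEx : E x ≠ 0 := fun h => hx (E.injective (h.trans (map_zero E).symm))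
  obtain ⟨j, hj⟩ := Finsupp.support_nonempty_iff.2 hEx
  -- normalise the coordinate `j` to `1`
  obtain ⟨z, hzI, hzs, hzj⟩ : ∃ z ∈ I, (E z).support ⊆ (E x).support ∧ E z j = 1 := by
    refine one_mem_span_of_ne_zero (Finsupp.mem_support_iff.1 hj)
      (p := fun a => ∃ z ∈ I, (E z).support ⊆ (E x).support ∧ E z j = a) ?_ ?_ ?_
    · exact ⟨0, I.zero_mem, by simp, by simp⟩
    · rintro _ _ ⟨z, hz, hs, rfl⟩ ⟨w, hw, ht, rfl⟩
      refine ⟨z + w, I.add_mem hz hw, ?_, by simp⟩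
      rw [map_add]
      exact Finsupp.support_add.trans (Finset.union_subset hs ht)
    · intro s t
      refine ⟨(s ⊗ₜ 1) * x * (t ⊗ₜ 1), I.mul_mem_right _ _ (I.mul_mem_left _ _ hxI), ?_, ?_⟩
      · intro i hi
        rw [Finsupp.mem_support_iff, hr, hl] at hi
        rw [Finsupp.mem_support_iff]
        intro h0
        exact hi (by simp [h0])
      · rw [hr, hl]
  have hcomm (a : A) : (a ⊗ₜ 1) * z = z * (a ⊗ₜ 1) := by
    by_contra hne
    have hwI : (a ⊗ₜ 1) * z - z * (a ⊗ₜ 1) ∈ I :=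
      I.sub_mem (I.mul_mem_left _ _ hzI) (I.mul_mem_right _ _ hzI)
    have hw (i) : E ((a ⊗ₜ 1) * z - z * (a ⊗ₜ 1)) i = a * E z i - E z i * a := by
      rw [map_sub, Finsupp.sub_apply, hr, hl]
    have hsub : (E ((a ⊗ₜ 1) * z - z * (a ⊗ₜ 1))).support ⊆ (E x).support := by
      intro i hi
      apply hzs
      rw [Finsupp.mem_support_iff, hw] at hi
      rw [Finsupp.mem_support_iff]
      intro h0
      exact hi (by simp [h0])
    have := hmin ⟨hwI, sub_ne_zero.2 hne⟩ hsub hj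
    rw [Finsupp.mem_support_iff, hw, hzj] at this
    exact this (by simp)
  have hcent (i) : ∃ r : F, r • (1 : A) = E z i := by
    have h : E z i ∈ Subalgebra.center F A := by
      rw [Subalgebra.mem_center_iff]
      intro a
      rw [← hl, ← hr, hcomm]
    rw [Algebra.IsCentral.center_eq_bot, Algebra.mem_bot] at h
    obtain ⟨r, hr⟩ := h
    exact ⟨r, by rw [← hr, Algebra.algebraMap_eq_smul_one]⟩
  choose f hf using hcent
  obtain ⟨y, hy⟩ : ∃ y : B, z = 1 ⊗ₜ y := by
    refine ⟨∑ i ∈ (E z).support, f i • b i, E.injective (Finsupp.ext fun i => ?_)⟩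
    rw [hE, ← hf i]
    simp only [map_sum, map_smul, Module.Basis.repr_self, Finsupp.coe_finsetSum,
      Finset.sum_apply, Finsupp.smul_apply, Finsupp.single_apply, smul_eq_mul, mul_ite, mul_one,
      mul_zero, Finset.sum_ite_eq']
    split_ifs with h
    · rfl
    · rw [zero_smul, ← Finsupp.notMem_support_iff.1 h]
      exact hf i
  have hy0 : y ≠ 0 := by
    rintro rfl
    rw [hy] at hzj
    simp at hzj
  have h1 : (1 : A) ⊗ₜ[F] (1 : B) ∈ I := by
    refine one_mem_span_of_ne_zero hy0 (p := fun t => (1 : A) ⊗ₜ[F] t ∈ I) ?_ ?_ ?_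
    · simp [I.zero_mem]
    · intro s t hs ht
      rw [TensorProduct.tmul_add]; exact I.add_mem hs ht
    · intro s t
      have := I.mul_mem_right _ (1 ⊗ₜ t) (I.mul_mem_left (1 ⊗ₜ s) _ hzI)
      rw [hy] at this
      simpa using this
  rw [eq_top_iff]
  intro t _
  have := I.mul_mem_left t _ h1
  rwa [← Algebra.TensorProduct.one_def, mul_one] at this

theorem center_subset (A : Type*) [Ring A] [Algebra F A] [h : Algebra.IsCentral F A] :
    Set.center A ⊆ Set.range fun r : F => r • (1 : A) := by
  intro x hx
  obtain ⟨r, hr⟩ := Algebra.mem_bot.1 (h.out (show x ∈ Subalgebra.center F A from hx))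
  exact ⟨r, by rw [← hr, Algebra.algebraMap_eq_smul_one]⟩

theorem isCentral_tensor (A B : Type*) [Ring A] [Algebra F A] [Ring B] [Algebra F B]
    [Algebra.IsCentral F A] [Algebra.IsCentral F B] [Nontrivial A] :
    Algebra.IsCentral F (A ⊗[F] B) := by
  refine ⟨fun x hx => ?_⟩
  obtain ⟨r, hr⟩ := center_tensor (F := F) (A := A) (B := B) (center_subset A) (center_subset B)
    (show x ∈ Set.center (A ⊗[F] B) from hx)
  exact Algebra.mem_bot.2 ⟨r, by rw [← hr, Algebra.algebraMap_eq_smul_one]⟩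

end Classical

namespace CSA

variable {F : Type u} [Field F]

/-- The tensor product of central simple algebras. -/
noncomputable def tensor (A B : CSA.{u, u} F) : CSA.{u, u} F :=
  haveI := isSimpleRing_tensor (F := F) A B
  haveI := isCentral_tensor (F := F) A B
  { AlgCat.of F (A ⊗[F] B) with
    isCentral := ‹_›
    isSimple := ‹_›
    fin_dim := inferInstanceAs (FiniteDimensional F (A ⊗[F] B)) }

/-- The field `F` as a central simple algebra over itself. -/
def unit (F : Type u) [Field F] : CSA.{u, u} F where
  toAlgCat := AlgCat.of F F
  isCentral := inferInstanceAs (Algebra.IsCentral F F)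
  isSimple := inferInstanceAs (IsSimpleRing F)
  fin_dim := inferInstanceAs (FiniteDimensional F F)

theorem equivalent_of_algEquiv {A B : CSA.{u, u} F} (e : A ≃ₐ[F] B) : IsBrauerEquivalent A B :=
  ⟨1, 1, one_ne_zero, one_ne_zero, ⟨e.mapMatrix⟩⟩

theorem tensor_equivalent {A A' B B' : CSA.{u, u} F} (h : IsBrauerEquivalent A A')
    (h' : IsBrauerEquivalent B B') : IsBrauerEquivalent (A.tensor B) (A'.tensor B') := by
  obtain ⟨n, n', hn, hn', ⟨e⟩⟩ := h
  obtain ⟨m, m', hm, hm', ⟨f⟩⟩ := h'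
  have key (C D : CSA.{u, u} F) (k l : ℕ) :
      Nonempty (Matrix (Fin (k * l)) (Fin (k * l)) (C ⊗[F] D) ≃ₐ[F]
        Matrix (Fin k) (Fin k) C ⊗[F] Matrix (Fin l) (Fin l) D) :=
    ⟨(Matrix.reindexAlgEquiv F _ finProdFinEquiv.symm).trans
      (Matrix.kroneckerTMulAlgEquiv (Fin k) (Fin l) F F C D).symm⟩
  obtain ⟨g⟩ := key A B n m
  obtain ⟨g'⟩ := key A' B' n' m'
  exact ⟨n * m, n' * m', Nat.mul_ne_zero hn hm, Nat.mul_ne_zero hn' hm',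
    ⟨g.trans ((Algebra.TensorProduct.congr e f).trans g'.symm)⟩⟩

end CSA

/-- The classical Brauer group as a monoid: the product is induced by the tensor product, and the
identity is the class of `F`. -/
noncomputable instance BrauerGroup.instCommMonoid (F : Type u) [Field F] :
    CommMonoid (BrauerGroup.{u, u} F) where
  mul := Quotient.map₂ CSA.tensor fun _ _ h _ _ h' => CSA.tensor_equivalent h h'
  one := Quotient.mk _ (CSA.unit F)
  mul_assoc := by
    rintro ⟨A⟩ ⟨B⟩ ⟨C⟩
    exact Quotient.sound (CSA.equivalent_of_algEquiv (A := (A.tensor B).tensor C)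
      (B := A.tensor (B.tensor C)) (Algebra.TensorProduct.assoc F F F A B C))
  one_mul := by
    rintro ⟨A⟩
    exact Quotient.sound (CSA.equivalent_of_algEquiv (A := (CSA.unit F).tensor A)
      (Algebra.TensorProduct.lid F A))
  mul_one := by
    rintro ⟨A⟩
    exact Quotient.sound (CSA.equivalent_of_algEquiv (A := A.tensor (CSA.unit F))
      (Algebra.TensorProduct.rid F F A))
  mul_comm := by
    rintro ⟨A⟩ ⟨B⟩
    exact Quotient.sound (CSA.equivalent_of_algEquiv (A := A.tensor B) (B := B.tensor A)
      (Algebra.TensorProduct.comm F A B))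

/-!
The nucleus of `A ⊗ M_n(F; c)` is `A ⊗ N`, where `N` is the nucleus of `M_n(F; c)`. It contains the
diagonal units `e_ii`, idempotents with sum `1` and one-dimensional corners, so every simple
quotient of `N` is a matrix algebra over `F`. Hence `A ⊗ N` has some `M_m(A)` as a quotient, and for
simple `A` every simple quotient of `A ⊗ N` is of this form. For skew equivalent simple algebras
`A` and `B` the two nuclei are isomorphic, and a simple quotient of the common nucleus is
simultaneously `M_m(A)` and `M_n(B)`.

A central simple algebra is `M_n(D)` with `D` a central division algebra. By the Jacobson–Noether
theorem a maximal separable subfield `L` of `D` is its own centralizer, so `(dim L)² = dim D`, and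
the diagonal matrices `Lⁿ` form an étale subalgebra `K` of `A` with `(dim K)² = dim A`. Since
`A ⊗ Aᵒᵖ` is simple, `K ⊗ K` acts faithfully on `A`; being a product of fields, it has a free orbit,
which fills `A` by dimension.
-/

/-! ## Nuclei of tensor products -/

section Nucleus

theorem mem_nucleus_iff {R : Type*} [NonUnitalNonAssocRing R] {x : R} :
    x ∈ nucleus R ↔ ∀ a b : R, x * a * b = x * (a * b) ∧ a * x * b = a * (x * b) ∧
      a * b * x = a * (b * x) := by
  simp only [nucleus, Set.mem_ofPred_eq, associator_apply, sub_eq_zero]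

theorem mul_mem_nucleus {R : Type*} [NonUnitalNonAssocRing R] {x y : R} (hx : x ∈ nucleus R)
    (hy : y ∈ nucleus R) : x * y ∈ nucleus R := by
  rw [mem_nucleus_iff] at *
  simp only [forall_and] at hx hy
  obtain ⟨hxl, hxm, hxr⟩ := hx
  obtain ⟨hyl, hym, hyr⟩ := hy
  refine fun a b => ⟨?_, ?_, ?_⟩
  · rw [hxl, hxl, hyl, ← hxl]
  · rw [← hxm, hym, hxm, ← hxl]
  · rw [← hxm, hxr, hyr, hyr]

theorem one_mem_nucleus {R : Type*} [NonAssocRing R] : (1 : R) ∈ nucleus R :=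
  mem_nucleus_iff.2 fun _ _ => by simp only [one_mul, mul_one, and_self]

theorem mem_nucleus_of_associative {R : Type*} [Ring R] (x : R) : x ∈ nucleus R :=
  mem_nucleus_iff.2 fun _ _ => by simp only [mul_assoc, and_self]

theorem IsAlgIso.map_one {F R R' : Type*} [Field F] [NonAssocRing R] [Module F R]
    [NonAssocRing R'] [Module F R'] {e : R ≃ₗ[F] R'} (he : ∀ x y, e (x * y) = e x * e y) :
    e 1 = 1 := by
  have h := he 1 (e.symm 1)
  rwa [one_mul, e.apply_symm_apply, mul_one, eq_comm] at h

variable (F : Type*) [Field F] (R : Type*) [NonAssocRing R] [Module F R] [SMulCommClass F R R]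
  [IsScalarTower F R R]

/-- The nucleus as a subspace closed under multiplication. -/
def nucleusSubalgebra : NonUnitalSubalgebra F R where
  carrier := nucleus R
  add_mem' := nucleus_add
  zero_mem' := mem_nucleus_iff.2 fun _ _ => by simp only [zero_mul, mul_zero, and_self]
  mul_mem' := mul_mem_nucleus
  smul_mem' r x hx := mem_nucleus_iff.2 fun a b => by
    obtain ⟨hl, hm, hr⟩ := mem_nucleus_iff.1 hx a b
    simp only [smul_mul_assoc, mul_smul_comm, hl, hm, hr, and_self]

/-- The nucleus as an associative unital algebra. -/
abbrev NucleusAlgebra : Type _ := nucleusSubalgebra F R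

namespace NucleusAlgebra

instance : Ring (NucleusAlgebra F R) where
  mul_assoc x _ _ := Subtype.ext (mem_nucleus_iff.1 x.2 _ _).1
  one := ⟨1, one_mem_nucleus⟩
  one_mul _ := Subtype.ext (one_mul _)
  mul_one _ := Subtype.ext (mul_one _)
  neg_add_cancel := neg_add_cancel
  sub_eq_add_neg := sub_eq_add_neg
  zsmul := zsmulRec

instance : Algebra F (NucleusAlgebra F R) :=
  Algebra.ofModule smul_mul_assoc mul_smul_comm

variable {F R}

instance [Nontrivial R] : Nontrivial (NucleusAlgebra F R) :=
  ⟨0, 1, fun h => zero_ne_one (congrArg Subtype.val h)⟩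

instance [Module.Finite F R] : Module.Finite F (NucleusAlgebra F R) :=
  inferInstanceAs (Module.Finite F (nucleusSubalgebra F R).toSubmodule)

end NucleusAlgebra

variable {F R}

theorem IsAlgIso.nonempty_nucleusAlgebra_algEquiv {R' : Type*} [NonAssocRing R'] [Module F R']
    [SMulCommClass F R' R'] [IsScalarTower F R' R'] (h : IsAlgIso F R R') :
    Nonempty (NucleusAlgebra F R ≃ₐ[F] NucleusAlgebra F R') := by
  obtain ⟨e, he⟩ := h
  have hmem (x : R) : x ∈ nucleus R ↔ e x ∈ nucleus R' := by
    simp only [mem_nucleus_iff, e.surjective.forall, ← he, e.injective.eq_iff]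
  have hmap : (nucleusSubalgebra F R).toSubmodule.map (e : R →ₗ[F] R') =
      (nucleusSubalgebra F R').toSubmodule := by
    ext y
    obtain ⟨x, rfl⟩ := e.surjective y
    rw [Submodule.mem_map_equiv, e.symm_apply_apply]
    exact hmem x
  exact ⟨.ofLinearEquiv (e.ofSubmodules _ _ hmap) (Subtype.ext (map_one he))
    fun x y => Subtype.ext (he x y)⟩

end Nucleus

section NucleusTensor

variable {F A R : Type*} [Field F] [Ring A] [Algebra F A] [NonAssocRing R] [Module F R]
  [SMulCommClass F R R] [IsScalarTower F R R]

theorem lid_rTensor_mem_nucleus (f : A →ₗ[F] F) {z : A ⊗[F] R}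
    (hz : z ∈ nucleus (A ⊗[F] R)) :
    TensorProduct.lid F R (f.rTensor R z) ∈ nucleus R := by
  set ψ : A ⊗[F] R →ₗ[F] R := (TensorProduct.lid F R).toLinearMap ∘ₗ f.rTensor R
  have hright (w : A ⊗[F] R) (x : R) : ψ (w * 1 ⊗ₜ x) = ψ w * x := by
    induction w with
    | zero => simp only [zero_mul, map_zero]
    | add w w' hw hw' => simp only [add_mul, map_add, hw, hw']
    | tmul a y => simp [ψ, smul_mul_assoc]
  have hleft (w : A ⊗[F] R) (x : R) : ψ (1 ⊗ₜ x * w) = x * ψ w := by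
    induction w with
    | zero => simp only [mul_zero, map_zero]
    | add w w' hw hw' => simp only [mul_add, map_add, hw, hw']
    | tmul a y => simp [ψ, mul_smul_comm]
  have hmul (x y : R) : (1 : A) ⊗ₜ[F] (x * y) = 1 ⊗ₜ x * 1 ⊗ₜ y := by
    rw [Algebra.TensorProduct.tmul_mul_tmul, one_mul]
  refine mem_nucleus_iff.2 fun x y => ?_
  obtain ⟨hl, hm, hr⟩ := mem_nucleus_iff.1 hz (1 ⊗ₜ x) (1 ⊗ₜ y)
  change ψ z * x * y = ψ z * (x * y) ∧ x * ψ z * y = x * (ψ z * y) ∧ x * y * ψ z = x * (y * ψ z)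
  simp only [← hright, ← hleft, hmul, hl, hm, hr, and_self]

variable (F A R)

/-- The inclusion `a ⊗ x ↦ a ⊗ x` from `A ⊗ N(R)` to the nucleus of `A ⊗ R`. -/
def tensorNucleusHom : A ⊗[F] NucleusAlgebra F R →ₐ[F] NucleusAlgebra F (A ⊗[F] R) :=
  Algebra.TensorProduct.algHomOfLinearMapTensorProduct
    (((nucleusSubalgebra F R).toSubmodule.subtype.lTensor A).codRestrict
      (nucleusSubalgebra F (A ⊗[F] R)).toSubmodule fun z => by
        induction z with
        | zero => simp only [map_zero, zero_mem]
        | add z w hz hw => simpa only [map_add] using add_mem hz hw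
        | tmul a x =>
          exact NuclearEmbedding.tmul_mem_nucleus (mem_nucleus_of_associative a) x.2)
    (fun a b x y => Subtype.ext (Algebra.TensorProduct.tmul_mul_tmul a b (x : R) (y : R)).symm)
    rfl

theorem tensorNucleusHom_bijective : Function.Bijective (tensorNucleusHom F A R) := by
  refine ⟨fun z w h => Module.Flat.lTensor_preserves_injective_linearMap (M := A) _
    (nucleusSubalgebra F R).toSubmodule.injective_subtype (congrArg Subtype.val h), ?_⟩
  rintro ⟨z, hz⟩
  let b := Module.Basis.ofVectorSpace F A
  classical
  let c := TensorProduct.equivFinsuppOfBasisLeft b z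
  have hc (i) : c i ∈ nucleus R := by
    rw [TensorProduct.equivFinsuppOfBasisLeft_apply]
    exact lid_rTensor_mem_nucleus (b.coord i) hz
  refine ⟨∑ i ∈ c.support, b i ⊗ₜ ⟨c i, hc i⟩, Subtype.ext ?_⟩
  calc ((tensorNucleusHom F A R (∑ i ∈ c.support, b i ⊗ₜ ⟨c i, hc i⟩) :
          NucleusAlgebra F (A ⊗[F] R)) : A ⊗[F] R)
      = ∑ i ∈ c.support, b i ⊗ₜ c i := by
        rw [map_sum, AddSubmonoidClass.coe_finsetSum]
        rfl
    _ = z := by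
        rw [← (TensorProduct.equivFinsuppOfBasisLeft b).symm_apply_apply z,
          TensorProduct.equivFinsuppOfBasisLeft_symm_apply]
        rfl

/-- The nucleus of `A ⊗ R` is `A ⊗ N(R)` for an associative algebra `A`. -/
noncomputable def tensorNucleusEquiv :
    A ⊗[F] NucleusAlgebra F R ≃ₐ[F] NucleusAlgebra F (A ⊗[F] R) :=
  .ofBijective (tensorNucleusHom F A R) (tensorNucleusHom_bijective F A R)

end NucleusTensor

namespace SkewMatrix

variable {F ι : Type*} [Field F] [DecidableEq ι] [Fintype ι] (c : SkewSet F ι)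

/-- The diagonal matrix unit `e_ii`. -/
def diagUnit (i : ι) : SkewMatrix c := fun k l => if k = i ∧ l = i then 1 else 0

instance : Module.Finite F (SkewMatrix c) := inferInstanceAs (Module.Finite F (Matrix ι ι F))

instance [Nonempty ι] : Nontrivial (SkewMatrix c) :=
  inferInstanceAs (Nontrivial (Matrix ι ι F))

theorem diagUnit_mul_apply (i : ι) (x : SkewMatrix c) (k l : ι) :
    (diagUnit c i * x) k l = if k = i then x k l else 0 := by
  rw [mul_apply, Finset.sum_eq_single i]
  · split_ifs with hk
    · subst hk
      simp [diagUnit, c.left_one]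
    · simp [diagUnit, hk]
  · intro m _ hm
    simp [diagUnit, hm]
  · simp

theorem mul_diagUnit_apply (i : ι) (x : SkewMatrix c) (k l : ι) :
    (x * diagUnit c i) k l = if l = i then x k l else 0 := by
  rw [mul_apply, Finset.sum_eq_single i]
  · split_ifs with hl
    · subst hl
      simp [diagUnit, c.right_one]
    · simp [diagUnit, hl]
  · intro m _ hm
    simp [diagUnit, hm]
  · simp

theorem diagUnit_mul_mul_diagUnit (i : ι) (x : SkewMatrix c) :
    diagUnit c i * x * diagUnit c i = x i i • diagUnit c i := by
  ext k l
  rw [mul_diagUnit_apply, diagUnit_mul_apply, smul_apply, diagUnit]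
  by_cases hk : k = i <;> by_cases hl : l = i <;> simp [hk, hl]

theorem isIdempotentElem_diagUnit (i : ι) : IsIdempotentElem (diagUnit c i) := by
  ext k l
  rw [diagUnit_mul_apply]
  by_cases hk : k = i <;> simp [diagUnit, hk]

theorem sum_diagUnit : ∑ i, diagUnit c i = 1 := by
  ext k l
  refine (Matrix.sum_apply k l Finset.univ (diagUnit c)).trans ?_
  simp [one_apply, diagUnit, ite_and, eq_comm]

theorem diagUnit_mem_nucleus (i : ι) : diagUnit c i ∈ nucleus (SkewMatrix c) := by
  refine mem_nucleus_iff.2 fun x y => ⟨?_, ?_, ?_⟩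
  all_goals ext k l
  · rw [diagUnit_mul_apply, mul_apply, mul_apply]
    simp only [diagUnit_mul_apply]
    split_ifs <;> simp
  · simp only [mul_apply _ _ k l, diagUnit_mul_apply, mul_diagUnit_apply, ite_mul, mul_ite,
      zero_mul, mul_zero]
  · rw [mul_diagUnit_apply, mul_apply, mul_apply]
    simp only [mul_diagUnit_apply]
    split_ifs <;> simp

end SkewMatrix

/-! ## Simple quotients of the nucleus -/

section DimensionFormula

variable {F S : Type*} [Field F] [Ring S] [Algebra F S]

theorem finrank_end_of_linearEquiv_fun {M V : Type*} [AddCommGroup M] [Module F M] [Module S M]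
    [IsScalarTower F S M] [AddCommGroup V] [Module F V] [Module S V] [IsScalarTower F S V]
    {n : ℕ} (e : M ≃ₗ[S] Fin n → V) :
    Module.finrank F (Module.End S M) = n ^ 2 * Module.finrank F (Module.End S V) := by
  let f := (e.conjAlgEquiv F).trans (endVecAlgEquivMatrixEnd (Fin n) F S V)
  rw [f.toLinearEquiv.finrank_eq, Module.finrank_matrix, Fintype.card_fin, sq]

variable (S) in
theorem exists_linearEquiv_fun_of_isSimpleModule [IsSimpleRing S] [IsArtinianRing S]
    (V M : Type*) [AddCommGroup V] [Module S V] [IsSimpleModule S V] [AddCommGroup M] [Module S M]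
    [Module.Finite S M] : ∃ n : ℕ, Nonempty (M ≃ₗ[S] Fin n → V) := by
  have hiso : IsIsotypicOfType S M V := fun U _ => by
    obtain ⟨I, ⟨e⟩⟩ := IsSemisimpleRing.exists_linearEquiv_ideal_of_isSimpleModule S U
    obtain ⟨J, ⟨e'⟩⟩ := IsSemisimpleRing.exists_linearEquiv_ideal_of_isSimpleModule S V
    have := IsSimpleModule.congr e.symm
    have := IsSimpleModule.congr e'.symm
    exact ⟨e.trans ((IsSimpleRing.isIsotypic S S J I).some.trans e'.symm)⟩
  exact hiso.linearEquiv_fun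

theorem finrank_mul_finrank_end [IsSimpleRing S] [Module.Finite F S] (M : Type*) [AddCommGroup M]
    [Module F M] [Module S M] [IsScalarTower F S M] [Module.Finite S M] :
    Module.finrank F S * Module.finrank F (Module.End S M) = Module.finrank F M ^ 2 := by
  have : IsArtinianRing S := .of_finite F S
  obtain ⟨V, hatom⟩ := IsAtomic.exists_atom (Ideal S)
  have : IsSimpleModule S V := isSimpleModule_iff_isAtom.2 hatom
  obtain ⟨m, ⟨eM⟩⟩ := exists_linearEquiv_fun_of_isSimpleModule S V M
  obtain ⟨n, ⟨eS⟩⟩ := exists_linearEquiv_fun_of_isSimpleModule S V S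
  set d := Module.finrank F (Module.End S V)
  have hM : Module.finrank F M = m * Module.finrank F V := by
    rw [(eM.restrictScalars F).finrank_eq, Module.finrank_pi_fintype]
    simp
  have hS : Module.finrank F S = n * Module.finrank F V := by
    rw [(eS.restrictScalars F).finrank_eq, Module.finrank_pi_fintype]
    simp
  have hSend : Module.finrank F S = n ^ 2 * d := by
    rw [← finrank_end_of_linearEquiv_fun eS, ← (AlgEquiv.moduleEndSelf F).toLinearEquiv.finrank_eq,
      (MulOpposite.opLinearEquiv F).finrank_eq]
  have hn : n ≠ 0 := by
    rintro rfl
    exact Module.finrank_pos.ne' (hS.trans (zero_mul _))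
  have hV : Module.finrank F V = n * d :=
    Nat.eq_of_mul_eq_mul_left (Nat.pos_of_ne_zero hn) (by rw [← hS, hSend]; ring)
  rw [finrank_end_of_linearEquiv_fun eM, hM, hSend, hV]
  ring

end DimensionFormula

section Splitting

/-- A decomposition of `1` into idempotents `e i` whose corners `e i * N * e i` are spanned by
`e i`. Orthogonality of the idempotents is not required. -/
structure IsSplitDecomposition (F : Type*) {ι N : Type*} [Fintype ι] [Field F] [Ring N]
    [Algebra F N] (e : ι → N) : Prop where
  isIdempotentElem (i : ι) : IsIdempotentElem (e i)
  exists_smul (i : ι) (x : N) : ∃ r : F, e i * x * e i = r • e i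
  sum_eq_one : ∑ i, e i = 1

namespace IsSplitDecomposition

variable {F ι N T : Type*} [Fintype ι] [Field F] [Ring N] [Algebra F N] [Ring T] [Algebra F T]
  {e : ι → N}

theorem map (he : IsSplitDecomposition F e) {f : N →ₐ[F] T} (hf : Function.Surjective f) :
    IsSplitDecomposition F (f ∘ e) where
  isIdempotentElem i := (he.isIdempotentElem i).map f
  exists_smul i := hf.forall.2 fun x => by
    obtain ⟨r, hr⟩ := he.exists_smul i x
    exact ⟨r, by rw [Function.comp_apply, ← map_mul, ← map_mul, hr, map_smul]⟩
  sum_eq_one := by simp only [Function.comp_apply, ← map_sum, he.sum_eq_one, map_one]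

theorem exists_ne_zero [Nontrivial N] (he : IsSplitDecomposition F e) : ∃ i, e i ≠ 0 := by
  by_contra! h
  exact zero_ne_one ((Finset.sum_eq_zero fun i _ => h i).symm.trans he.sum_eq_one)

end IsSplitDecomposition

variable {F T : Type*} [Field F] [Ring T] [Algebra F T]

theorem finrank_end_span_singleton_le_one {e : T} (he : IsIdempotentElem e)
    (hscalar : ∀ x, ∃ r : F, e * x * e = r • e) :
    Module.finrank F (Module.End T (Ideal.span {e})) ≤ 1 := by
  let e' : Ideal.span {e} := ⟨e, Ideal.mem_span_singleton_self e⟩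
  have hmul_e (y : Ideal.span {e}) : (y : T) * e = y := by
    obtain ⟨z, hz⟩ := Ideal.mem_span_singleton'.1 y.2
    rw [← hz, mul_assoc, he.eq]
  have hgen (y : Ideal.span {e}) : y = (y : T) • e' := Subtype.ext (hmul_e y).symm
  refine finrank_le_one LinearMap.id fun f => ?_
  obtain ⟨r, hr⟩ := hscalar (f e')
  have hfe : f e' = r • e' := by
    have hfix : e • f e' = f e' := by rw [← map_smul, ← hgen e']
    refine Subtype.ext (Eq.trans ?_ hr)
    rw [mul_assoc, hmul_e]
    exact (congrArg Subtype.val hfix).symm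
  refine ⟨r, LinearMap.ext fun y => ?_⟩
  rw [hgen y, map_smul, map_smul, hfe]
  rfl

theorem nonempty_algEquiv_matrix_of_idempotent [IsSimpleRing T] [Module.Finite F T] {e : T}
    (he : IsIdempotentElem e) (he₀ : e ≠ 0) (hscalar : ∀ x, ∃ r : F, e * x * e = r • e) :
    ∃ n : ℕ, n ≠ 0 ∧ Nonempty (T ≃ₐ[F] Matrix (Fin n) (Fin n) F) := by
  let M : Ideal T := Ideal.span {e}
  have : Nontrivial M :=
    ⟨⟨e, Ideal.mem_span_singleton_self e⟩, 0, fun h => he₀ (congrArg Subtype.val h)⟩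
  have hM : 0 < Module.finrank F M := Module.finrank_pos
  have hdim := finrank_mul_finrank_end (F := F) (S := T) M
  have hend : Module.finrank F (Module.End T M) = 1 := by
    refine le_antisymm (finrank_end_span_singleton_le_one he hscalar)
      (Nat.one_le_iff_ne_zero.2 fun h => ?_)
    rw [h, mul_zero] at hdim
    exact (pow_pos hM 2).ne hdim
  let ρ : T →ₐ[F] Module.End F M := Algebra.lsmul F F M
  have hinj : Function.Injective ρ := ρ.toRingHom.injective
  have hfinrank : Module.finrank F T = Module.finrank F (Module.End F M) := by
    rw [Module.finrank_linearMap, ← sq, ← hdim, hend, mul_one]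
  have hsurj : Function.Surjective ρ :=
    (LinearMap.injective_iff_surjective_of_finrank_eq_finrank (f := ρ.toLinearMap) hfinrank).1 hinj
  exact ⟨_, hM.ne', ⟨(AlgEquiv.ofBijective ρ ⟨hinj, hsurj⟩).trans
    (algEquivMatrix (Module.finBasis F M))⟩⟩

theorem map_one_tmul_mul_eq_zero_of_corner_eq_zero {A S : Type*} [Ring A] [Algebra F A] [Ring S]
    [Algebra F S] [IsSimpleRing S] {π : A ⊗[F] T →ₐ[F] S} (hπ : Function.Surjective π)
    {e x : T} (hx : π (1 ⊗ₜ x) ≠ 0) (hcorner : ∀ u v, e * (u * x * v) * e = 0) :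
    π (1 ⊗ₜ (e * e)) = 0 := by
  have hspan : π (1 ⊗ₜ e) * 1 * π (1 ⊗ₜ e) = 0 := by
    refine one_mem_span_of_ne_zero hx (p := fun y => π (1 ⊗ₜ e) * y * π (1 ⊗ₜ e) = 0)
      (by rw [mul_zero, zero_mul])
      (fun y z hy hz => by rw [mul_add, add_mul, hy, hz, add_zero])
      (hπ.forall₂.2 fun s t => ?_)
    simp only [← map_mul]
    induction s with
    | zero => simp only [zero_mul, mul_zero, map_zero]
    | add s s' hs hs' => simp only [add_mul, mul_add, map_add, hs, hs', add_zero]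
    | tmul a u =>
      induction t with
      | zero => simp only [zero_mul, mul_zero, map_zero]
      | add t t' ht ht' => simp only [mul_add, add_mul, map_add, ht, ht', add_zero]
      | tmul b v =>
        simp only [Algebra.TensorProduct.tmul_mul_tmul, hcorner, TensorProduct.tmul_zero, map_zero]
  rwa [mul_one, ← map_mul, Algebra.TensorProduct.tmul_mul_tmul, one_mul] at hspan

theorem IsSplitDecomposition.isSimpleRing {A S ι : Type*} [Ring A] [Algebra F A] [Ring S]
    [Algebra F S] [IsSimpleRing S] [Fintype ι] {e : ι → T} (he : IsSplitDecomposition F e)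
    {π : A ⊗[F] T →ₐ[F] S} (hπ : Function.Surjective π)
    (hinj : Function.Injective fun t => π (1 ⊗ₜ t)) : IsSimpleRing T := by
  have hzero {t : T} (ht : π (1 ⊗ₜ t) = 0) : t = 0 :=
    hinj (ht.trans (by simp only [TensorProduct.tmul_zero, map_zero]))
  have : Nontrivial T := by
    refine ⟨1, 0, fun h => one_ne_zero (α := S) ?_⟩
    rw [← map_one π, Algebra.TensorProduct.one_def, h, TensorProduct.tmul_zero, map_zero]
  refine isSimpleRing_iff_isTwoSided_imp.2 ⟨inferInstance, fun I _ => or_iff_not_imp_left.2 ?_⟩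
  intro hI
  obtain ⟨x, hx, hx₀⟩ := Submodule.exists_mem_ne_zero_of_ne_bot hI
  have hmem (i : ι) : e i ∈ I := by
    by_contra hei
    have hcorner (u v : T) : e i * (u * x * v) * e i = 0 := by
      have hcornerI : e i * (u * x * v) * e i ∈ I := I.mul_mem_right _ <| I.mul_mem_left _ <|
        I.mul_mem_right _ <| I.mul_mem_left _ hx
      obtain ⟨r, hr⟩ := he.exists_smul i (u * x * v)
      rw [hr] at hcornerI ⊢
      rcases eq_or_ne r 0 with rfl | hr₀
      · rw [zero_smul]
      · exact absurd (inv_smul_smul₀ hr₀ (e i) ▸ I.smul_of_tower_mem r⁻¹ hcornerI) hei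
    have hei₀ := hzero (map_one_tmul_mul_eq_zero_of_corner_eq_zero hπ (mt hzero hx₀) hcorner)
    rw [(he.isIdempotentElem i).eq] at hei₀
    exact hei (hei₀ ▸ I.zero_mem)
  exact (Ideal.eq_top_iff_one I).2 (he.sum_eq_one ▸ I.sum_mem fun i _ => hmem i)

theorem exists_surjective_tensor_range {A N S : Type*} [Ring A] [Algebra F A] [Ring N]
    [Algebra F N] [Ring S] [Algebra F S] {π : A ⊗[F] N →ₐ[F] S} (hπ : Function.Surjective π) :
    ∃ π' : A ⊗[F] (π.comp Algebra.TensorProduct.includeRight).range →ₐ[F] S,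
      Function.Surjective π' ∧ ∀ t, π' (1 ⊗ₜ t) = t := by
  let j : N →ₐ[F] S := π.comp Algebra.TensorProduct.includeRight
  have hcomm (a : A) (t : j.range) : Commute (π (a ⊗ₜ 1)) (t : S) := by
    obtain ⟨_, x, rfl⟩ := t
    change π (a ⊗ₜ 1) * π (1 ⊗ₜ x) = π (1 ⊗ₜ x) * π (a ⊗ₜ 1)
    simp only [← map_mul, Algebra.TensorProduct.tmul_mul_tmul, one_mul, mul_one]
  let π' : A ⊗[F] j.range →ₐ[F] S :=
    Algebra.TensorProduct.lift (π.comp Algebra.TensorProduct.includeLeft) j.range.val hcomm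
  have hπ'_tmul (a : A) (t : j.range) : π' (a ⊗ₜ t) = π (a ⊗ₜ 1) * t :=
    Algebra.TensorProduct.lift_tmul _ _ hcomm a t
  have hfactor : π'.comp (Algebra.TensorProduct.map (.id F A) j.rangeRestrict) = π := by
    refine Algebra.TensorProduct.ext' fun a x => ?_
    refine (hπ'_tmul a (j.rangeRestrict x)).trans ?_
    change π (a ⊗ₜ 1) * π (1 ⊗ₜ x) = _
    rw [← map_mul, Algebra.TensorProduct.tmul_mul_tmul, one_mul, mul_one]
  refine ⟨π', fun y => ?_, fun t => ?_⟩
  · obtain ⟨z, rfl⟩ := hπ y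
    exact ⟨_, DFunLike.congr_fun hfactor z⟩
  · rw [hπ'_tmul, ← Algebra.TensorProduct.one_def, map_one, one_mul]

theorem IsSplitDecomposition.nonempty_algEquiv_matrix_of_surjective {A N S ι : Type*} [Ring A]
    [Algebra F A] [IsSimpleRing A] [Ring N] [Algebra F N] [Module.Finite F N] [Ring S]
    [Algebra F S] [IsSimpleRing S] [Fintype ι] {e : ι → N} (he : IsSplitDecomposition F e)
    {π : A ⊗[F] N →ₐ[F] S} (hπ : Function.Surjective π) :
    ∃ n : ℕ, n ≠ 0 ∧ Nonempty (Matrix (Fin n) (Fin n) A ≃ₐ[F] S) := by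
  let j : N →ₐ[F] S := π.comp Algebra.TensorProduct.includeRight
  obtain ⟨π', hπ', hone_tmul⟩ : ∃ π' : A ⊗[F] j.range →ₐ[F] S, _ :=
    exists_surjective_tensor_range hπ
  have he' := he.map j.rangeRestrict_surjective
  have : IsSimpleRing j.range := he'.isSimpleRing hπ' fun t t' h => Subtype.ext <| by
    simpa only [hone_tmul] using h
  have : Module.Finite F j.range := .of_surjective j.rangeRestrict.toLinearMap
    j.rangeRestrict_surjective
  obtain ⟨i, hi⟩ := he'.exists_ne_zero
  obtain ⟨n, hn, ⟨f⟩⟩ := nonempty_algEquiv_matrix_of_idempotent (he'.isIdempotentElem i) hi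
    (he'.exists_smul i)
  let g : Matrix (Fin n) (Fin n) A ≃ₐ[F] A ⊗[F] j.range :=
    (matrixEquivTensor (Fin n) F A).trans (Algebra.TensorProduct.congr .refl f.symm)
  have : NeZero n := ⟨hn⟩
  exact ⟨n, hn, ⟨.ofBijective (π'.comp g.toAlgHom)
    ⟨(π'.comp g.toAlgHom).toRingHom.injective, hπ'.comp g.surjective⟩⟩⟩

theorem exists_isSimpleRing_quotient (N : Type*) [Ring N] [Nontrivial N] [IsNoetherianRing N] :
    ∃ (I : Ideal N) (_ : I.IsTwoSided), IsSimpleRing (N ⧸ I) := by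
  obtain ⟨I, ⟨hI, hne⟩, hmax⟩ := exists_maximal_of_wellFoundedGT
    (fun I : Ideal N => I.IsTwoSided ∧ I ≠ ⊤) ⟨⊥, inferInstance, bot_ne_top⟩
  refine ⟨I, hI, isSimpleRing_iff_isTwoSided_imp.2
    ⟨Ideal.Quotient.nontrivial_iff.2 hne, fun J hJ => or_iff_not_imp_right.2 fun hJne => ?_⟩⟩
  have hcomap : Ideal.comap (Ideal.Quotient.mk I) ⊥ = I := Ideal.mk_ker
  have hle : I ≤ J.comap (Ideal.Quotient.mk I) := hcomap.symm.trans_le (Ideal.comap_mono bot_le)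
  refine Ideal.comap_injective_of_surjective _ Ideal.Quotient.mk_surjective ?_
  rw [hcomap]
  refine le_antisymm (hmax ⟨inferInstance, fun h => hJne ?_⟩ hle) hle
  exact Ideal.comap_eq_top_iff.1 h

theorem IsSplitDecomposition.exists_surjective_matrix (A : Type*) {N ι : Type*} [Ring A]
    [Algebra F A] [Ring N] [Algebra F N] [Module.Finite F N] [Nontrivial N] [Fintype ι]
    {e : ι → N} (he : IsSplitDecomposition F e) :
    ∃ n : ℕ, n ≠ 0 ∧ ∃ π : A ⊗[F] N →ₐ[F] Matrix (Fin n) (Fin n) A, Function.Surjective π := by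
  have : IsNoetherianRing N := isNoetherian_of_tower F inferInstance
  obtain ⟨I, _, _⟩ := exists_isSimpleRing_quotient N
  have hI := Ideal.Quotient.mkₐ_surjective F I
  have he' := he.map hI
  obtain ⟨i, hi⟩ := he'.exists_ne_zero
  obtain ⟨n, hn, ⟨f⟩⟩ := nonempty_algEquiv_matrix_of_idempotent (he'.isIdempotentElem i) hi
    (he'.exists_smul i)
  let g := (Algebra.TensorProduct.congr (.refl : A ≃ₐ[F] A) f).trans
    (matrixEquivTensor (Fin n) F A).symm
  exact ⟨n, hn, g.toAlgHom.comp (Algebra.TensorProduct.map (.id F A) (Ideal.Quotient.mkₐ F I)),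
    g.surjective.comp (TensorProduct.map_surjective Function.surjective_id hI)⟩

end Splitting

section SkewMatrixNucleus

variable {F ι : Type*} [Field F] [DecidableEq ι] [Fintype ι] (c : SkewSet F ι)

theorem SkewMatrix.isSplitDecomposition_diagUnit : IsSplitDecomposition F
    fun i => (⟨diagUnit c i, diagUnit_mem_nucleus c i⟩ : NucleusAlgebra F (SkewMatrix c)) where
  isIdempotentElem i := Subtype.ext (isIdempotentElem_diagUnit c i)
  exists_smul i x := ⟨(x : SkewMatrix c) i i, Subtype.ext (diagUnit_mul_mul_diagUnit c i x)⟩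
  sum_eq_one := Subtype.ext <|
    (AddSubmonoidClass.coe_finsetSum _ _).trans (sum_diagUnit c)

end SkewMatrixNucleus

theorem IsSkewEquivalent.exists_algEquiv_matrix {F A B : Type*} [Field F] [Ring A] [Algebra F A]
    [IsSimpleRing A] [Ring B] [Algebra F B] [IsSimpleRing B] (h : IsSkewEquivalent F A B) :
    ∃ m n : ℕ, m ≠ 0 ∧ n ≠ 0 ∧
      Nonempty (Matrix (Fin m) (Fin m) A ≃ₐ[F] Matrix (Fin n) (Fin n) B) := by
  obtain ⟨k, l, c, d, hk, -, h⟩ := h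
  have : NeZero k := ⟨hk.ne'⟩
  obtain ⟨e⟩ := h.nonempty_nucleusAlgebra_algEquiv
  let f : B ⊗[F] NucleusAlgebra F (SkewMatrix d) ≃ₐ[F] A ⊗[F] NucleusAlgebra F (SkewMatrix c) :=
    (tensorNucleusEquiv F B (SkewMatrix d)).trans
      (e.symm.trans (tensorNucleusEquiv F A (SkewMatrix c)).symm)
  obtain ⟨m, hm, π, hπ⟩ :=
    (SkewMatrix.isSplitDecomposition_diagUnit c).exists_surjective_matrix A
  have : NeZero m := ⟨hm⟩
  obtain ⟨n, hn, ⟨g⟩⟩ :=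
    (SkewMatrix.isSplitDecomposition_diagUnit d).nonempty_algEquiv_matrix_of_surjective
      (π := π.comp f.toAlgHom) (hπ.comp f.surjective)
  exact ⟨m, n, hm, hn, ⟨g.symm⟩⟩

/-! ## Centralizers and separable subfields -/

section Centralizer

theorem finrank_mul_finrank_centralizer_range_end {F S M : Type*} [Field F] [Ring S] [Algebra F S]
    [IsSimpleRing S] [Module.Finite F S] [AddCommGroup M] [Module F M] [Module.Finite F M]
    (ρ : S →ₐ[F] Module.End F M) :
    Module.finrank F S * Module.finrank F (Subalgebra.centralizer F (Set.range ρ)) =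
      Module.finrank F M ^ 2 := by
  let : Module S M := Module.compHom M ρ.toRingHom
  have : IsScalarTower F S M := ⟨fun r s x => LinearMap.congr_fun (map_smul ρ r s) x⟩
  have : Module.Finite S M := .of_restrictScalars_finite F S M
  let e : Module.End S M ≃ₗ[F] Subalgebra.centralizer F (Set.range ρ) :=
    { toFun f := ⟨f.restrictScalars F, by
        rintro _ ⟨s, rfl⟩
        exact LinearMap.ext fun x => (f.map_smul s x).symm⟩
      map_add' _ _ := rfl
      map_smul' _ _ := rfl
      invFun f :=
        { f.1 with map_smul' s x := (LinearMap.congr_fun (f.2 (ρ s) ⟨s, rfl⟩) x).symm } }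
  rw [← e.finrank_eq, finrank_mul_finrank_end]

variable {F A : Type*} [Field F] [Ring A] [Algebra F A]

/-- The bimodule action of `A ⊗ Lᵐᵒᵖ` on `A` given by an algebra map `g : L → A`. -/
noncomputable def bimoduleAction {L : Type*} [Ring L] [Algebra F L] (g : L →ₐ[F] A) :
    A ⊗[F] Lᵐᵒᵖ →ₐ[F] Module.End F A :=
  (AlgHom.mulLeftRight F A).comp (Algebra.TensorProduct.map (.id F A) g.op)

theorem bimoduleAction_tmul {L : Type*} [Ring L] [Algebra F L] (g : L →ₐ[F] A) (a : A) (l : Lᵐᵒᵖ)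
    (x : A) : bimoduleAction g (a ⊗ₜ l) x = a * x * g l.unop :=
  AlgHom.mulLeftRight_apply F A a (.op (g l.unop)) x

/-- Evaluation at `1` identifies the endomorphisms commuting with the bimodule action of `g` with
the centralizer of the image of `g`, acting on `A` by right multiplication. -/
def centralizerBimoduleActionEquiv {L : Type*} [Ring L] [Algebra F L] (g : L →ₐ[F] A) :
    Subalgebra.centralizer F (Set.range (bimoduleAction g)) ≃ₗ[F]
      Subalgebra.centralizer F (Set.range g) where
  toFun f := ⟨f.1 1, by
    rintro _ ⟨l, rfl⟩
    have hl := LinearMap.congr_fun (f.2 _ ⟨1 ⊗ₜ .op l, rfl⟩) 1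
    have hr := LinearMap.congr_fun (f.2 _ ⟨g l ⊗ₜ 1, rfl⟩) 1
    simp only [Module.End.mul_apply, bimoduleAction_tmul, MulOpposite.unop_op,
      MulOpposite.unop_one, map_one, one_mul, mul_one] at hl hr
    rw [hl, hr]⟩
  map_add' _ _ := rfl
  map_smul' _ _ := rfl
  invFun c := ⟨LinearMap.mulRight F c.1, by
    rintro _ ⟨z, rfl⟩
    induction z with
    | zero => rw [map_zero, zero_mul, mul_zero]
    | add z w hz hw => rw [map_add, add_mul, mul_add, hz, hw]
    | tmul a l =>
      ext x
      simp only [Module.End.mul_apply, bimoduleAction_tmul, LinearMap.mulRight_apply, mul_assoc,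
        c.2 (g l.unop) ⟨_, rfl⟩]⟩
  left_inv f := Subtype.ext <| LinearMap.ext fun a => by
    have ha := LinearMap.congr_fun (f.2 _ ⟨a ⊗ₜ 1, rfl⟩) 1
    simpa only [Module.End.mul_apply, bimoduleAction_tmul, MulOpposite.unop_one, map_one, mul_one,
      LinearMap.mulRight_apply] using ha
  right_inv c := Subtype.ext (one_mul _)

theorem finrank_mul_finrank_centralizer [Algebra.IsCentral F A] [IsSimpleRing A]
    [Module.Finite F A] {L : Type*} [Ring L] [Algebra F L] [IsSimpleRing L] (g : L →ₐ[F] A) :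
    Module.finrank F L * Module.finrank F (Subalgebra.centralizer F (Set.range g)) =
      Module.finrank F A := by
  have : Module.Finite F L := .of_injective g.toLinearMap g.toRingHom.injective
  have := isSimpleRing_tensor (F := F) A Lᵐᵒᵖ
  have h := finrank_mul_finrank_centralizer_range_end (bimoduleAction g)
  rw [(centralizerBimoduleActionEquiv g).finrank_eq, Module.finrank_tensorProduct,
    ← (MulOpposite.opLinearEquiv F : L ≃ₗ[F] Lᵐᵒᵖ).finrank_eq, sq, mul_assoc] at h
  exact Nat.eq_of_mul_eq_mul_left Module.finrank_pos h

end Centralizer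

section SeparableSubfields

/-- The algebra map from `L[X] / (minpoly L x)` sending the root to `x`, for `x` in a possibly
noncommutative algebra. -/
noncomputable def adjoinRootMinpolyHom {L C : Type*} [Field L] [Ring C] [Algebra L C] (x : C) :
    AdjoinRoot (minpoly L x) →ₐ[L] C :=
  Ideal.Quotient.liftₐ (Ideal.span {minpoly L x}) (Polynomial.aeval x) fun q hq => by
    obtain ⟨q, rfl⟩ := Ideal.mem_span_singleton'.1 hq
    rw [map_mul, minpoly.aeval, mul_zero]

theorem isSeparable_adjoinRoot {L : Type*} [Field L] {p : Polynomial L} [Fact (Irreducible p)]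
    (hp : p.Separable) : Algebra.IsSeparable L (AdjoinRoot p) := by
  have hroot : IsSeparable L (AdjoinRoot.root p) := by
    refine hp.of_dvd ?_
    exact minpoly.dvd _ _ (by rw [AdjoinRoot.aeval_eq, AdjoinRoot.mk_self])
  have hadjoin := (IntermediateField.isSeparable_adjoin_simple_iff_isSeparable _ _).2 hroot
  rw [IntermediateField.adjoin_root_eq_top] at hadjoin
  exact AlgEquiv.Algebra.isSeparable (IntermediateField.topEquiv (F := L) (E := AdjoinRoot p))

theorem exists_separable_extension_of_isCentral {F C : Type*} {L : Type v} [Field F] [Field L]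
    [Algebra F L] [Module.Finite F L] [Algebra.IsSeparable F L] [DivisionRing C] [Algebra F C]
    [Algebra L C] [IsScalarTower F L C] [Algebra.IsAlgebraic L C] [Algebra.IsCentral L C]
    (hbot : (⊥ : Subalgebra L C) ≠ ⊤) :
    ∃ (M : Type v) (_ : Field M) (_ : Algebra F M),
      Algebra.IsSeparable F M ∧ Nonempty (M →ₐ[F] C) ∧
        Module.finrank F L < Module.finrank F M := by
  obtain ⟨x, hx, hsep⟩ := JacobsonNoether.exists_separable_and_not_isCentral' hbot
  have hint : IsIntegral L x := hsep.isIntegral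
  have : Fact (Irreducible (minpoly L x)) := ⟨minpoly.irreducible hint⟩
  have hp : minpoly L x ≠ 0 := minpoly.ne_zero hint
  have : Module.Finite L (AdjoinRoot (minpoly L x)) := (AdjoinRoot.powerBasis hp).finite
  have := isSeparable_adjoinRoot hsep
  refine ⟨AdjoinRoot (minpoly L x), inferInstance, inferInstance, .trans F L _,
    ⟨(adjoinRootMinpolyHom x).restrictScalars F⟩, ?_⟩
  rw [← Module.finrank_mul_finrank F L (AdjoinRoot (minpoly L x)),
    (AdjoinRoot.powerBasis hp).finrank, AdjoinRoot.powerBasis_dim]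
  exact lt_mul_of_one_lt_right Module.finrank_pos
    ((minpoly.two_le_natDegree_iff hint).2 fun h => hx (Algebra.mem_bot.2 h))

variable {F D : Type*} [Field F] [DivisionRing D] [Algebra F D] [Module.Finite F D]
  [Algebra.IsCentral F D]

theorem centralizer_centralizer_range {L : Type*} [Ring L] [IsSimpleRing L] [Algebra F L]
    (g : L →ₐ[F] D) :
    Subalgebra.centralizer F (Subalgebra.centralizer F (Set.range g) : Set D) = g.range := by
  let C := Subalgebra.centralizer F (Set.range g)
  let : DivisionRing C := divisionRingOfFiniteDimensional F C
  have hL := finrank_mul_finrank_centralizer g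
  have hC := finrank_mul_finrank_centralizer C.val
  have hrange : Set.range C.val = C := Subtype.range_val
  rw [← hL, mul_comm, congrArg (Subalgebra.centralizer F) hrange] at hC
  refine (Subalgebra.eq_of_le_of_finrank_eq ?_ ?_).symm
  · exact Subalgebra.le_centralizer_centralizer F
  · rw [Nat.eq_of_mul_eq_mul_right Module.finrank_pos hC]
    exact (AlgEquiv.ofInjective g g.toRingHom.injective).symm.toLinearEquiv.finrank_eq

theorem exists_larger_separable {L : Type v} [Field L] [Algebra F L] [Algebra.IsSeparable F L]
    (g : L →ₐ[F] D)
    (hne : Module.finrank F L ≠ Module.finrank F (Subalgebra.centralizer F (Set.range g))) :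
    ∃ (M : Type v) (_ : Field M) (_ : Algebra F M),
      Algebra.IsSeparable F M ∧ Nonempty (M →ₐ[F] D) ∧
        Module.finrank F L < Module.finrank F M := by
  have : Module.Finite F L := .of_injective g.toLinearMap g.toRingHom.injective
  let C := Subalgebra.centralizer F (Set.range g)
  let : DivisionRing C := divisionRingOfFiniteDimensional F C
  let g' : L →ₐ[F] C := g.codRestrict C fun l => by
    rintro _ ⟨m, rfl⟩
    rw [← map_mul, mul_comm, map_mul]
  let : Algebra L C := g'.toRingHom.toAlgebra' fun l x => Subtype.ext (x.2 _ ⟨l, rfl⟩)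
  have : IsScalarTower F L C := .of_algebraMap_eq' g'.comp_algebraMap.symm
  have : Module.Finite L C := .of_restrictScalars_finite F L C
  have : Algebra.IsCentral L C := ⟨fun x hx => by
    have hx' : (x : D) ∈ g.range := by
      rw [← centralizer_centralizer_range g]
      exact fun y hy => congrArg Subtype.val (Subalgebra.mem_center_iff.1 hx ⟨y, hy⟩)
    obtain ⟨l, hl⟩ := hx'
    exact Algebra.mem_bot.2 ⟨l, Subtype.ext hl⟩⟩
  have hbot : (⊥ : Subalgebra L C) ≠ ⊤ := fun h => hne <| LinearEquiv.finrank_eq <|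
    .ofBijective g'.toLinearMap
      ⟨g'.toRingHom.injective, fun x => Algebra.mem_bot.1 (h ▸ Algebra.mem_top)⟩
  obtain ⟨M, _, _, hsep, ⟨f⟩, hlt⟩ := exists_separable_extension_of_isCentral (F := F) hbot
  exact ⟨M, _, _, hsep, ⟨C.val.comp f⟩, hlt⟩

theorem exists_separable_finrank_sq (F : Type*) (D : Type v) [Field F] [DivisionRing D]
    [Algebra F D] [Algebra.IsCentral F D] [Module.Finite F D] :
    ∃ (L : Type v) (_ : Field L) (_ : Algebra F L),
      Algebra.IsSeparable F L ∧ Nonempty (L →ₐ[F] D) ∧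
        Module.finrank F L ^ 2 = Module.finrank F D := by
  classical
  let IsDegree (n : ℕ) : Prop := ∃ (L : Type v) (_ : Field L) (_ : Algebra F L),
    Algebra.IsSeparable F L ∧ Nonempty (L →ₐ[F] D) ∧ Module.finrank F L = n
  have hle {n : ℕ} : IsDegree n → n ≤ Module.finrank F D := by
    rintro ⟨L, _, _, -, ⟨g⟩, rfl⟩
    exact LinearMap.finrank_le_finrank_of_injective (f := g.toLinearMap) g.toRingHom.injective
  have hone : IsDegree 1 := by
    have e : (⊥ : Subalgebra F D) ≃ₐ[F] F := Algebra.botEquiv F D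
    let : Field (⊥ : Subalgebra F D) := (e.toMulEquiv.isField (Field.toIsField F)).toField
    exact ⟨(⊥ : Subalgebra F D), inferInstance, inferInstance,
      AlgEquiv.Algebra.isSeparable e.symm, ⟨Subalgebra.val _⟩, Subalgebra.finrank_bot⟩
  obtain ⟨L, _, _, hsep, ⟨g⟩, hL⟩ : IsDegree (Nat.findGreatest IsDegree (Module.finrank F D)) :=
    Nat.findGreatest_spec (hle hone) hone
  refine ⟨L, _, _, hsep, ⟨g⟩, ?_⟩
  have : Module.Finite F L := .of_injective g.toLinearMap g.toRingHom.injective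
  rw [← finrank_mul_finrank_centralizer g, sq]
  congr 1
  by_contra hne
  obtain ⟨M, _, _, hsepM, hM, hlt⟩ := exists_larger_separable g hne
  have hmax : IsDegree (Module.finrank F M) := ⟨M, _, _, hsepM, hM, rfl⟩
  exact (Nat.le_findGreatest (hle hmax) hmax).not_gt (hL ▸ hlt)

end SeparableSubfields

/-! ## Étale subalgebras of central simple algebras -/

section NuclearEmbeddingOfAlgHom

variable {F A K : Type*} [Field F] [Ring A] [Algebra F A] [CommRing K] [Algebra F K]

/-- An injective algebra map into an associative algebra, as a nuclear embedding. -/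
def NuclearEmbedding.ofAlgHom (f : K →ₐ[F] A) (hf : Function.Injective f) :
    NuclearEmbedding F K A where
  toLinearMap := f.toLinearMap
  map_one := _root_.map_one f
  map_mul := _root_.map_mul f
  injective := hf
  mem_nucleus k := mem_nucleus_of_associative (f k)

variable [Algebra.IsCentral F A] [IsSimpleRing A]

theorem NuclearEmbedding.biAction_ofAlgHom_injective (f : K →ₐ[F] A) (hf : Function.Injective f) :
    Function.Injective (NuclearEmbedding.ofAlgHom f hf).biAction := by
  have := isSimpleRing_tensor (F := F) A Aᵐᵒᵖ
  let fop : K →ₗ[F] Aᵐᵒᵖ := (MulOpposite.opLinearEquiv F).toLinearMap ∘ₗ f.toLinearMap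
  have hfop : Function.Injective fop := (MulOpposite.opLinearEquiv F).injective.comp hf
  have hmul : Function.Injective (AlgHom.mulLeftRight F A) :=
    (AlgHom.mulLeftRight F A).toRingHom.injective
  convert hmul.comp (TensorProduct.map_injective_of_flat_flat f.toLinearMap fop hf hfop) using 1
  funext z
  rw [Function.comp_apply]
  induction z with
  | zero => simp only [map_zero]
  | add z w hz hw => simp only [map_add, hz, hw]
  | tmul k l =>
    ext a
    rw [NuclearEmbedding.biAction_tmul, TensorProduct.map_tmul, AlgHom.mulLeftRight_apply,
      mul_assoc]
    rfl

end NuclearEmbeddingOfAlgHom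

theorem IsSemiassociative.of_etale {F : Type u} {A K : Type v} [Field F] [Ring A] [Algebra F A]
    [Algebra.IsCentral F A] [IsSimpleRing A] [Module.Finite F A] [CommRing K] [Algebra F K]
    [Algebra.Etale F K] (f : K →ₐ[F] A) (hf : Function.Injective f)
    (hdim : Module.finrank F K ^ 2 = Module.finrank F A) :
    IsSemiassociative F A where
  finite := inferInstance
  nontrivial := inferInstance
  center_eq := (center_subset A).antisymm (by rintro _ ⟨r, rfl⟩; exact smul_one_mem_center r)
  exists_etale := by
    let φ := NuclearEmbedding.ofAlgHom f hf
    refine ⟨K, inferInstance, inferInstance, inferInstance, φ,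
      (minimallyFaithful_iff_of_etale φ).2 ?_⟩
    have := etale_tensor (F := F) K K
    have : Module.Finite F K := Algebra.FormallyUnramified.finite_of_free F _
    have : IsReduced (K ⊗[F] K) := Algebra.FormallyUnramified.isReduced_of_field F _
    have : IsArtinianRing (K ⊗[F] K) := IsArtinianRing.of_finite F _
    let := φ.bimodule
    have : FaithfulSMul (K ⊗[F] K) A :=
      ⟨fun h => NuclearEmbedding.biAction_ofAlgHom_injective f hf (LinearMap.ext h)⟩
    obtain ⟨v, hv⟩ := exists_smul_injective (R := K ⊗[F] K) (M := A)
    let orbit : K ⊗[F] K →ₗ[F] A := LinearMap.applyₗ v ∘ₗ φ.biAction.toLinearMap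
    exact ⟨v, hv, (LinearMap.injective_iff_surjective_of_finrank_eq_finrank (f := orbit)
      (by rw [Module.finrank_tensorProduct, ← sq, hdim])).1 hv⟩

theorem isCentral_of_isCentral_matrix {F D ι : Type*} [Field F] [Ring D] [Algebra F D] [Fintype ι]
    [DecidableEq ι] [Nonempty ι] [Algebra.IsCentral F (Matrix ι ι D)] : Algebra.IsCentral F D where
  out d hd := by
    have hscalar : Matrix.scalar ι d ∈ Subalgebra.center F (Matrix ι ι D) := by
      rw [Matrix.subalgebraCenter_eq_scalarAlgHom_map]
      exact ⟨d, hd, rfl⟩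
    rw [Algebra.IsCentral.center_eq_bot, Algebra.mem_bot] at hscalar
    obtain ⟨r, hr⟩ := hscalar
    obtain ⟨i⟩ := ‹Nonempty ι›
    refine Algebra.mem_bot.2 ⟨r, ?_⟩
    simpa [Matrix.algebraMap_matrix_apply] using congrFun (congrFun hr i) i

theorem exists_etale_finrank_sq (F : Type*) (A : Type v) [Field F] [Ring A] [Algebra F A]
    [Algebra.IsCentral F A] [IsSimpleRing A] [Module.Finite F A] :
    ∃ (K : Type v) (_ : CommRing K) (_ : Algebra F K) (f : K →ₐ[F] A),
      Algebra.Etale F K ∧ Function.Injective f ∧ Module.finrank F K ^ 2 = Module.finrank F A := by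
  have : IsArtinianRing A := IsArtinianRing.of_finite F A
  obtain ⟨n, _, D, _, _, _, ⟨e⟩⟩ := IsSimpleRing.exists_algEquiv_matrix_divisionRing_finite F A
  have : Algebra.IsCentral F (Matrix (Fin n) (Fin n) D) := .of_algEquiv F _ _ e
  have : Algebra.IsCentral F D := isCentral_of_isCentral_matrix (ι := Fin n)
  obtain ⟨L, _, _, _, ⟨g⟩, hL⟩ := exists_separable_finrank_sq F D
  have : Module.Finite F L := .of_injective g.toLinearMap g.toRingHom.injective
  have : Algebra.FormallyEtale F L := .of_isSeparable F L
  have : Algebra.FinitePresentation F L := Algebra.FinitePresentation.of_finiteType.1 inferInstance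
  have : Algebra.Etale F L := {}
  let diag : (Fin n → L) →ₐ[F] Matrix (Fin n) (Fin n) D :=
    (Matrix.diagonalAlgHom F).comp (g.compLeft (Fin n))
  have hdiag : Function.Injective diag :=
    Matrix.diagonal_injective.comp g.toRingHom.injective.comp_left
  refine ⟨Fin n → L, inferInstance, inferInstance, e.symm.toAlgHom.comp diag, inferInstance,
    e.symm.injective.comp hdiag, ?_⟩
  rw [e.toLinearEquiv.finrank_eq, Module.finrank_matrix, Module.finrank_pi_fintype, ← hL,
    Finset.sum_const, Finset.card_univ, Fintype.card_fin, smul_eq_mul]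
  ring

theorem IsSemiassociative.of_isCentral_of_isSimpleRing (F : Type u) (A : Type v) [Field F]
    [Ring A] [Algebra F A] [Algebra.IsCentral F A] [IsSimpleRing A] [Module.Finite F A] :
    IsSemiassociative F A := by
  obtain ⟨K, _, _, f, _, hf, hdim⟩ := exists_etale_finrank_sq F A
  exact .of_etale f hf hdim

/-! ## The embedding of the Brauer group -/

theorem exists_isAlgIso_tensor_skewMatrix_matrix (F A : Type*) [Field F] [Ring A] [Algebra F A]
    (n : ℕ) :
    ∃ c : SkewSet F (Fin n), IsAlgIso F (A ⊗[F] SkewMatrix c) (Matrix (Fin n) (Fin n) A) := by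
  let c : SkewSet F (Fin n) := ⟨fun _ _ _ => 1, fun _ _ => rfl, fun _ _ => rfl⟩
  have hc : IsAlgIso F (SkewMatrix c) (Matrix (Fin n) (Fin n) F) :=
    ⟨LinearEquiv.refl F (Matrix (Fin n) (Fin n) F), fun x y => by
      ext i j
      refine (SkewMatrix.mul_apply x y i j).trans ?_
      simp only [c, one_mul]
      exact (Matrix.mul_apply ..).symm⟩
  let e := (matrixEquivTensor (Fin n) F A).symm
  exact ⟨c, (IsAlgIso.refl.tensor hc).trans ⟨e.toLinearEquiv, map_mul e⟩⟩

theorem IsSkewEquivalent.of_matrix_algEquiv {F A B : Type*} [Field F] [Ring A] [Algebra F A]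
    [Ring B] [Algebra F B] {m n : ℕ} (hm : m ≠ 0) (hn : n ≠ 0)
    (e : Matrix (Fin m) (Fin m) A ≃ₐ[F] Matrix (Fin n) (Fin n) B) : IsSkewEquivalent F A B := by
  obtain ⟨c, hc⟩ := exists_isAlgIso_tensor_skewMatrix_matrix F A m
  obtain ⟨d, hd⟩ := exists_isAlgIso_tensor_skewMatrix_matrix F B n
  exact ⟨m, n, c, d, Nat.pos_of_ne_zero hm, Nat.pos_of_ne_zero hn,
    hc.trans (.trans ⟨e.toLinearEquiv, map_mul e⟩ hd.symm)⟩

/-- The map `[A] ↦ [A]ˢᵃ` from the Brauer group to the semiassociative Brauer monoid. -/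
noncomputable def brauerToSemiassoc (F : Type u) [Field F] :
    BrauerGroup.{u, u} F →* SemiassocBrauerMonoid F where
  toFun := Quotient.lift
    (fun A => SemiassocBrauerMonoid.mk ⟨A, .of_isCentral_of_isSimpleRing F A⟩)
    fun _ _ ⟨_, _, hm, hn, ⟨e⟩⟩ => Quotient.sound (.of_matrix_algEquiv hm hn e)
  map_one' := rfl
  map_mul' := by
    rintro ⟨A⟩ ⟨B⟩
    exact Quotient.sound (.of_iso ⟨LinearEquiv.refl F (A ⊗[F] B), fun _ _ => rfl⟩)

theorem brauerToSemiassoc_injective (F : Type u) [Field F] :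
    Function.Injective (brauerToSemiassoc F) := by
  rintro ⟨A⟩ ⟨B⟩ h
  have hskew : IsSkewEquivalent F A B := Quotient.exact h
  exact Quotient.sound hskew.exists_algEquiv_matrix

theorem mainTheorem4_general (F : Type u) [Field F] :
    (∀ (A : Type v) (B : Type w) [Ring A] [Algebra F A] [IsSimpleRing A] [Ring B] [Algebra F B]
      [IsSimpleRing B], IsSkewEquivalent F A B → ∃ m n : ℕ, m ≠ 0 ∧ n ≠ 0 ∧
        Nonempty (Matrix (Fin m) (Fin m) A ≃ₐ[F] Matrix (Fin n) (Fin n) B)) ∧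
    ∃ f : BrauerGroup.{u, u} F →* SemiassocBrauerMonoid F, Function.Injective f ∧
      ∀ A : CSA.{u, u} F, ∃ h : IsSemiassociative F A,
        f (Quotient.mk (Brauer.CSA_Setoid F) A) =
          SemiassocBrauerMonoid.mk { carrier := A, isSemiassociative := h } :=
  ⟨fun _ _ _ _ _ _ _ _ h => h.exists_algEquiv_matrix, brauerToSemiassoc F,
    brauerToSemiassoc_injective F, fun A => ⟨.of_isCentral_of_isSimpleRing F A, rfl⟩⟩

theorem mainTheorem4 (F : Type u) [Field F] :
    (∀ A B : CSA.{u, v} F, IsSkewEquivalent F A B → IsBrauerEquivalent A B) ∧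
    ∃ f : BrauerGroup.{u, u} F →* SemiassocBrauerMonoid F, Function.Injective f ∧
      ∀ A : CSA.{u, u} F, ∃ h : IsSemiassociative F A,
        f (Quotient.mk (Brauer.CSA_Setoid F) A) =
          SemiassocBrauerMonoid.mk { carrier := A, isSemiassociative := h } :=
  (mainTheorem4_general F).imp_left fun h A B => h A B
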